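/- Let $q$ be an indeterminate. For $s\in\mathbb{Z}_{\ge 0}$ put $[s]=(1-q^s)/(1-q)$, for $x\in\mathbb{Q}(q)$ and $k\in\mathbb{Z}_{\ge 0}$ put $(x;q^3)_k=\prod_{j=0}^{k-1}(1-xq^{3j})$, let $\Phi_n(q)$ be the $n$-th cyclotomic polynomial, and for $k\ge 0$ put $$A_q(k)=[6k+1]\,\frac{(q;q^3)_k^6}{(q^3;q^3)_k^6}\,q^{3k}.$$ For $f,g\in\mathbb{Q}(q)$ and a nonzero polynomial $P\in\mathbb{Q}[q]$, write $f\equiv g\pmod{P}$ if $P$ divides the numerator of $f-g$ written in lowest terms. Let $n$ be a positive integer with $n\equiv 1\pmod 3$. Then $$\sum_{\substack{i,j\ge 0\\ i+j\le n-1}}A_q(i)A_q(j)\equiv [n]^2\,\frac{(q^2;q^3)_{(n-1)/3}^6}{(q^3;q^3)_{(n-1)/3}^6}\left\{1+2[n]^2(2-q^n)\sum_{r=1}^{(n-1)/3}\left(\frac{q^{3r-1}}{[3r-1]^2}-\frac{q^{3r}}{[3r]^2}\right)\right\}\pmod{\Phi_n(q)^6}.$$ -/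

import Mathlib

open Polynomial

noncomputable section

/-- The `q`-shifted factorial `(x; q)_k = (1 - x) (1 - x q) ⋯ (1 - x q ^ (k - 1))`. -/
def qShiftedFactorial {K : Type*} [Field K] (x q : K) (k : ℕ) : K :=
  ∏ j ∈ Finset.range k, (1 - x * q ^ j)

/-- The `q`-integer `[s] = (1 - q ^ s) / (1 - q)`. -/
def qInteger {K : Type*} [Field K] (q : K) (s : ℕ) : K :=
  (1 - q ^ s) / (1 - q)

/-- The term `A_q(k) = [6 k + 1] (q; q ^ 3)_k ^ 6 / (q ^ 3; q ^ 3)_k ^ 6 * q ^ (3 k)`. -/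
def termA {K : Type*} [Field K] (q : K) (k : ℕ) : K :=
  qInteger q (6 * k + 1) *
    (qShiftedFactorial q (q ^ 3) k ^ 6 / qShiftedFactorial (q ^ 3) (q ^ 3) k ^ 6) * q ^ (3 * k)

/-- Congruence of rational functions in one variable modulo a polynomial `P`: the difference,
written as a quotient of coprime polynomials, has its numerator divisible by `P`. -/
def RatFuncCongr (P : ℚ[X]) (f g : RatFunc ℚ) : Prop :=
  P ∣ (f - g).num

end

/-! Put `M = (n - 1) / 3` and measure divisibility by Φ_n with its valuation on ℚ(q). For `M < k <
n` the product (q; q^3)_k contains 1 - q^n, so A_q(k) is divisible by Φ_n^6. The double sum is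
therefore congruent to S^2, where S is the sum of A_q(k) over `k ≤ M` (`double_sum_termA_congr`).

To evaluate S^2, put y = q^(-n) and lam = (y - 1)^5 / y, and replace five of the six parameters q by
q u, with u running over the roots of (X - 1)^5 = lam X. One root is y, so the deformed series S'
terminates at `k = M`; the roots have product 1, so it is balanced. Jackson's ₈φ₇ summation
(`jackson_sum`) then gives S' as a product. Since lam is divisible by Φ_n^5, S ≡ S' modulo Φ_n^5
(`deformedTerm_congr`); both sums are divisible by Φ_n, so S^2 ≡ S'^2 modulo Φ_n^6.

The product for S' is not symmetric in the other four roots. After squaring, the reflection j ↦ M -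
1 - j matches each pair of roots with the complementary pair, and S'^2 becomes rational in q and y
(`sq_sum_deformedTerm`). It is [n]^2 times a product that is needed only modulo Φ_n^4, and expanding
that product in powers of y - 1 gives the right-hand side (`prod_factor_congr`). -/

section Jackson

/-! ### Jackson's terminating ₈φ₇ summation. -/

variable {K : Type*} [Field K]

theorem qShiftedFactorial_zero (x q : K) : qShiftedFactorial x q 0 = 1 := by
  simp [qShiftedFactorial]

theorem qShiftedFactorial_succ (x q : K) (k : ℕ) :
    qShiftedFactorial x q (k + 1) = qShiftedFactorial x q k * (1 - x * q ^ k) :=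
  Finset.prod_range_succ _ _

theorem qShiftedFactorial_succ' (x q : K) (k : ℕ) :
    qShiftedFactorial x q (k + 1) = (1 - x) * qShiftedFactorial (x * q) q k := by
  rw [qShiftedFactorial, Finset.prod_range_succ', mul_comm]
  simp [qShiftedFactorial, pow_succ', mul_assoc]

theorem qShiftedFactorial_ne_zero {x q : K} {k : ℕ} (h : ∀ j < k, x * q ^ j ≠ 1) :
    qShiftedFactorial x q k ≠ 0 := by
  refine Finset.prod_ne_zero_iff.2 fun j hj => ?_
  exact sub_ne_zero.2 (h j (Finset.mem_range.1 hj)).symm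

/-- The summand of a very-well-poised balanced `₈φ₇` series whose last two parameters are `a / s`
and `a q / t`. -/
def jacksonTerm (q a b c d s t : K) (k : ℕ) : K :=
  (1 - a * q ^ (2 * k)) *
    (qShiftedFactorial a q k * qShiftedFactorial b q k * qShiftedFactorial c q k *
      qShiftedFactorial d q k * qShiftedFactorial (a / s) q k *
      qShiftedFactorial (a * q / t) q k) /
    (qShiftedFactorial q q k * qShiftedFactorial (a * q / b) q k *
      qShiftedFactorial (a * q / c) q k * qShiftedFactorial (a * q / d) q k *
      qShiftedFactorial (s * q) q k * qShiftedFactorial t q k) * q ^ k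

/-- The polynomial core of the telescoping step, with `x` in the role of q^k; the balancing
condition `s * t = b * c * d` is what makes it hold. -/
theorem jackson_core {a b c d s t x : K} (hb : b ≠ 0) (hc : c ≠ 0) (hd : d ≠ 0) (hs : s ≠ 0)
    (ht : s * t = b * c * d) :
    (1 - a * x ^ 2) * x * ((1 - a * x / s) * (1 - a / t) * (1 - s * x) *
        ((1 - t / b) * (1 - t / c) * (1 - t / d)) +
      s * ((1 - b / s) * (1 - c / s) * (1 - d / s)) * (1 - a / s) * (1 - a * x / t) *
        (1 - t * x)) =
    (1 - t / s) * ((1 - a * x) * (1 - b * x) * (1 - c * x) * (1 - d * x) * (1 - a * x / s) *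
        (1 - a * x / t) -
      (1 - x) * (1 - a * x / b) * (1 - a * x / c) * (1 - a * x / d) * (1 - s * x) *
        (1 - t * x)) := by
  obtain rfl : t = b * c * d / s := by field_simp; linear_combination ht
  field_simp
  ring

/-- The ratio of consecutive values of the product side of Jackson's summation. -/
def jacksonRatio (b c d s t : K) : K :=
  (1 - t) * ((1 - b / s) * (1 - c / s) * (1 - d / s)) /
    ((1 - t / b) * (1 - t / c) * (1 - t / d) * (1 - 1 / s))

/-- The telescoping certificate, at index `k + 1`. -/
def jacksonCert (q a b c d s t : K) (k : ℕ) : K :=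
  (1 - t) * (1 - t / s) / ((1 - t / b) * (1 - t / c) * (1 - t / d)) *
    (qShiftedFactorial a q (k + 1) * qShiftedFactorial b q (k + 1) *
      qShiftedFactorial c q (k + 1) * qShiftedFactorial d q (k + 1) *
      qShiftedFactorial (a * q / s) q k * qShiftedFactorial (a * q / t) q k) /
    (qShiftedFactorial q q k * qShiftedFactorial (a * q / b) q k *
      qShiftedFactorial (a * q / c) q k * qShiftedFactorial (a * q / d) q k *
      qShiftedFactorial s q (k + 1) * qShiftedFactorial t q (k + 1))

theorem jackson_scaled {a b c d s t x : K} (hb : b ≠ 0) (hc : c ≠ 0) (hd : d ≠ 0) (hs : s ≠ 0)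
    (ht : s * t = b * c * d) (htb : t ≠ b) (htc : t ≠ c) (htd : t ≠ d) (hs1 : s ≠ 1)
    (hsx : s * x ≠ 1) (htx : t * x ≠ 1) :
    (1 - a * x ^ 2) * x * ((1 - a * x / s) * (1 - a / t) * (1 - t) / (1 - t * x) -
      jacksonRatio b c d s t * ((1 - a / s) * (1 - a * x / t) * (1 - s) / (1 - s * x))) =
    (1 - t) * (1 - t / s) / ((1 - t / b) * (1 - t / c) * (1 - t / d)) *
      ((1 - a * x) * (1 - b * x) * (1 - c * x) * (1 - d * x) * (1 - a * x / s) *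
        (1 - a * x / t) / ((1 - s * x) * (1 - t * x)) -
      (1 - x) * (1 - a * x / b) * (1 - a * x / c) * (1 - a * x / d)) := by
  have key := jackson_core (a := a) (x := x) hb hc hd hs ht
  have h1 : 1 - t / b ≠ 0 := by
    rw [sub_ne_zero, ne_comm, Ne, div_eq_one_iff_eq hb]; exact htb
  have h2 : 1 - t / c ≠ 0 := by
    rw [sub_ne_zero, ne_comm, Ne, div_eq_one_iff_eq hc]; exact htc
  have h3 : 1 - t / d ≠ 0 := by
    rw [sub_ne_zero, ne_comm, Ne, div_eq_one_iff_eq hd]; exact htd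
  have h4 : 1 - s * x ≠ 0 := sub_ne_zero.2 hsx.symm
  have h5 : 1 - t * x ≠ 0 := sub_ne_zero.2 htx.symm
  have h6 : 1 - s ≠ 0 := sub_ne_zero.2 hs1.symm
  have h7 : (1 : K) - 1 / s = -(1 - s) / s := by field_simp; ring
  rw [jacksonRatio, h7]
  generalize 1 - t / b = B at *
  generalize 1 - t / c = C at *
  generalize 1 - t / d = D at *
  generalize 1 - b / s = B' at *
  generalize 1 - c / s = C' at *
  generalize 1 - d / s = D' at *
  generalize 1 - a / s = A1 at *
  generalize 1 - a / t = A2 at *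
  generalize 1 - a * x / s = A3 at *
  generalize 1 - a * x / t = A4 at *
  generalize 1 - t / s = A5 at *
  generalize 1 - a * x / b = A6 at *
  generalize 1 - a * x / c = A7 at *
  generalize 1 - a * x / d = A8 at *
  generalize 1 - s * x = S at *
  generalize 1 - t * x = T at *
  generalize 1 - s = S1 at *
  generalize 1 - t = T1 at *
  field_simp
  linear_combination (T1) * key

theorem jackson_cert_zero {q a b c d s t : K} (hb : b ≠ 0) (hc : c ≠ 0) (hd : d ≠ 0)
    (hs : s ≠ 0) (ht : s * t = b * c * d) (htb : t ≠ b) (htc : t ≠ c) (htd : t ≠ d)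
    (hs1 : s ≠ 1) (ht1 : t ≠ 1) :
    (1 - a) * (1 - jacksonRatio b c d s t) = jacksonCert q a b c d s t 0 := by
  have h1 : b - t ≠ 0 := sub_ne_zero.2 htb.symm
  have h2 : c - t ≠ 0 := sub_ne_zero.2 htc.symm
  have h3 : d - t ≠ 0 := sub_ne_zero.2 htd.symm
  have h6 : s - 1 ≠ 0 := sub_ne_zero.2 hs1
  have h6' : 1 - s ≠ 0 := sub_ne_zero.2 hs1.symm
  have h7 : 1 - t ≠ 0 := sub_ne_zero.2 ht1.symm
  have e1 : 1 - t / b = (b - t) / b := by field_simp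
  have e2 : 1 - t / c = (c - t) / c := by field_simp
  have e3 : 1 - t / d = (d - t) / d := by field_simp
  have e4 : 1 - 1 / s = (s - 1) / s := by field_simp
  simp only [jacksonRatio, jacksonCert, qShiftedFactorial_zero, qShiftedFactorial_succ, e1, e2, e3,
    e4, pow_zero, mul_one, one_mul]
  have key : (b - t) * (c - t) * (d - t) * (s - 1) * s ^ 2 -
      (1 - t) * ((s - b) * (s - c) * (s - d)) * (b * c * d) =
      (1 - b) * (1 - c) * (1 - d) * (t - s) * (b * c * d) * s := by
    obtain rfl : t = b * c * d / s := by field_simp; linear_combination ht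
    field_simp
    ring
  rw [← neg_sub s 1]
  field_simp
  linear_combination (1 - a) * key

/-- A contiguous relation: the move (s, t) ↦ (s / q, t q) preserves the balance, and each summand is
the difference of consecutive values of `jacksonCert`. -/
theorem jackson_telescope {q a b c d s t : K} (hq0 : q ≠ 0) (hb : b ≠ 0) (hc : c ≠ 0) (hd : d ≠ 0)
    (hs : s ≠ 0) (hst : s * t = b * c * d) (htb : t ≠ b) (htc : t ≠ c) (htd : t ≠ d) (m : ℕ)
    (hq : ∀ j, 1 ≤ j → j ≤ m → q ^ j ≠ 1) (hab : ∀ j, 1 ≤ j → j ≤ m → a * q ^ j ≠ b)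
    (hac : ∀ j, 1 ≤ j → j ≤ m → a * q ^ j ≠ c) (had : ∀ j, 1 ≤ j → j ≤ m → a * q ^ j ≠ d)
    (hsq : ∀ j ≤ m, s * q ^ j ≠ 1) (htq : ∀ j ≤ m, t * q ^ j ≠ 1) :
    ∑ k ∈ Finset.range (m + 1), (jacksonTerm q a b c d (s / q) (t * q) k -
      jacksonRatio b c d s t * jacksonTerm q a b c d s t k) = jacksonCert q a b c d s t m := by
  have hs1 : s ≠ 1 := by simpa using hsq 0 (Nat.zero_le _)
  have ht1 : t ≠ 1 := by simpa using htq 0 (Nat.zero_le _)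
  induction m with
  | zero =>
    rw [← jackson_cert_zero hb hc hd hs hst htb htc htd hs1 ht1]
    simp [jacksonTerm, qShiftedFactorial_zero]
    ring
  | succ m ih =>
    rw [Finset.sum_range_succ, ih (fun j h1 h2 => hq j h1 (by omega))
      (fun j h1 h2 => hab j h1 (by omega)) (fun j h1 h2 => hac j h1 (by omega))
      (fun j h1 h2 => had j h1 (by omega)) (fun j h => hsq j (by omega))
      (fun j h => htq j (by omega))]
    have key := jackson_scaled (a := a) (x := q ^ (m + 1)) hb hc hd hs hst htb htc htd hs1
      (hsq (m + 1) le_rfl) (htq (m + 1) le_rfl)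
    have hE : a / (s / q) = a * q / s := by field_simp
    have hF : a * q / (t * q) = a / t := by field_simp
    have hS : s / q * q = s := by field_simp
    have qm : q * q ^ m = q ^ (m + 1) := by ring
    have am (z : K) : a * q / z * q ^ m = a * q ^ (m + 1) / z := by ring
    have eQ : qShiftedFactorial q q (m + 1) = qShiftedFactorial q q m * (1 - q ^ (m + 1)) := by
      rw [qShiftedFactorial_succ, qm]
    have eA (z : K) : qShiftedFactorial (a * q / z) q (m + 1) =
        qShiftedFactorial (a * q / z) q m * (1 - a * q ^ (m + 1) / z) := by
      rw [qShiftedFactorial_succ, am]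
    have eE : qShiftedFactorial (a / s) q (m + 1) =
        (1 - a / s) * qShiftedFactorial (a * q / s) q m := by
      rw [qShiftedFactorial_succ', div_mul_eq_mul_div]
    have eF : qShiftedFactorial (a / t) q (m + 1) =
        (1 - a / t) * qShiftedFactorial (a * q / t) q m := by
      rw [qShiftedFactorial_succ', div_mul_eq_mul_div]
    have n1 : 1 - s ≠ 0 := sub_ne_zero.2 hs1.symm
    have n2 : 1 - t ≠ 0 := sub_ne_zero.2 ht1.symm
    have eS : qShiftedFactorial (s * q) q (m + 1) =
        qShiftedFactorial s q (m + 1) * (1 - s * q ^ (m + 1)) / (1 - s) := by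
      rw [eq_div_iff n1, ← qShiftedFactorial_succ, qShiftedFactorial_succ' s, mul_comm]
    have eT : qShiftedFactorial (t * q) q (m + 1) =
        qShiftedFactorial t q (m + 1) * (1 - t * q ^ (m + 1)) / (1 - t) := by
      rw [eq_div_iff n2, ← qShiftedFactorial_succ, qShiftedFactorial_succ' t, mul_comm]
    have hz : ∀ z : K, z ≠ 0 → (∀ j, 1 ≤ j → j ≤ m + 1 → a * q ^ j ≠ z) →
        qShiftedFactorial (a * q / z) q m ≠ 0 ∧ 1 - a * q ^ (m + 1) / z ≠ 0 := by
      intro z hz0 hz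
      refine ⟨qShiftedFactorial_ne_zero fun j hj => ?_, ?_⟩
      · have := hz (j + 1) (by omega) (by omega)
        contrapose! this
        field_simp at this
        rw [← this]; ring
      · rw [sub_ne_zero, ne_comm, Ne, div_eq_one_iff_eq hz0]
        exact hz _ (by omega) le_rfl
    obtain ⟨nb, nb'⟩ := hz b hb hab
    obtain ⟨nc, nc'⟩ := hz c hc hac
    obtain ⟨nd, nd'⟩ := hz d hd had
    have nq : qShiftedFactorial q q m ≠ 0 := by
      refine qShiftedFactorial_ne_zero fun j hj => ?_
      rw [← pow_succ']; exact hq _ (by omega) (by omega)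
    have nq' : 1 - q ^ (m + 1) ≠ 0 := sub_ne_zero.2 (hq _ (by omega) le_rfl).symm
    have ns : qShiftedFactorial s q (m + 1) ≠ 0 :=
      qShiftedFactorial_ne_zero fun j hj => hsq j (by omega)
    have nt : qShiftedFactorial t q (m + 1) ≠ 0 :=
      qShiftedFactorial_ne_zero fun j hj => htq j (by omega)
    have ns' : 1 - s * q ^ (m + 1) ≠ 0 := sub_ne_zero.2 (hsq _ le_rfl).symm
    have nt' : 1 - t * q ^ (m + 1) ≠ 0 := sub_ne_zero.2 (htq _ le_rfl).symm
    have q2 : q ^ (2 * (m + 1)) = (q ^ (m + 1)) ^ 2 := by rw [← pow_mul, mul_comm]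
    rw [jacksonTerm, jacksonTerm, jacksonCert, jacksonCert, hE, hF, hS, q2]
    simp only [qShiftedFactorial_succ s q (m + 1), qShiftedFactorial_succ t q (m + 1),
      qShiftedFactorial_succ a q (m + 1), qShiftedFactorial_succ b q (m + 1),
      qShiftedFactorial_succ c q (m + 1), qShiftedFactorial_succ d q (m + 1), eQ, eA, eE, eF, eS,
      eT]
    generalize (1 - t) * (1 - t / s) / ((1 - t / b) * (1 - t / c) * (1 - t / d)) = κ at *
    generalize jacksonRatio b c d s t = ρ at *
    generalize qShiftedFactorial a q (m + 1) = Xa at *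
    generalize qShiftedFactorial b q (m + 1) = Xb at *
    generalize qShiftedFactorial c q (m + 1) = Xc at *
    generalize qShiftedFactorial d q (m + 1) = Xd at *
    generalize qShiftedFactorial s q (m + 1) = Xs at *
    generalize qShiftedFactorial t q (m + 1) = Xt at *
    generalize qShiftedFactorial (a * q / s) q m = E at *
    generalize qShiftedFactorial (a * q / t) q m = F at *
    generalize qShiftedFactorial (a * q / b) q m = B at *
    generalize qShiftedFactorial (a * q / c) q m = C at *
    generalize qShiftedFactorial (a * q / d) q m = D at *
    generalize qShiftedFactorial q q m = Q at *
    generalize q ^ (m + 1) = x at *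
    -- The scaled identity times the shifted factorials common to all terms is the increment of the
    -- certificate.
    have hW := congrArg (fun z => Xa * Xb * Xc * Xd * E * F /
      (Q * (1 - x) * (B * (1 - a * x / b)) * (C * (1 - a * x / c)) * (D * (1 - a * x / d)) *
        Xs * Xt) * z) key
    generalize 1 - a * x / b = vb at *
    generalize 1 - a * x / c = vc at *
    generalize 1 - a * x / d = vd at *
    generalize 1 - s * x = vs at *
    generalize 1 - t * x = vt at *
    generalize 1 - x = vx at *
    generalize 1 - s = v1 at *
    generalize 1 - t = v2 at *
    generalize 1 - a * x / s = v3 at *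
    generalize 1 - a * x / t = v4 at *
    generalize 1 - a / s = v5 at *
    generalize 1 - a / t = v6 at *
    generalize 1 - a * x ^ 2 = w0 at *
    generalize 1 - a * x = w1 at *
    generalize 1 - b * x = w2 at *
    generalize 1 - c * x = w3 at *
    generalize 1 - d * x = w4 at *
    clear ih eA hz key
    rw [← eq_sub_iff_add_eq']
    convert hW using 1
    · field_simp
    · field_simp

/-- For t = a q^(N + 1) the last parameter a q / t is q^(-N), so raising `N` by one is the move t ↦
t q of the contiguous relation, and `jacksonRatio` is the ratio of the two closed forms. -/
theorem jackson_sum {q a b c d : K} (hq0 : q ≠ 0) (ha : a ≠ 0) (hb : b ≠ 0) (hc : c ≠ 0)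
    (hd : d ≠ 0) (hq : ∀ j, 1 ≤ j → q ^ j ≠ 1) (haq : ∀ j, 1 ≤ j → a * q ^ j ≠ 1) (N : ℕ)
    (hab : ∀ j, 1 ≤ j → j ≤ N → a * q ^ j ≠ b) (hac : ∀ j, 1 ≤ j → j ≤ N → a * q ^ j ≠ c)
    (had : ∀ j, 1 ≤ j → j ≤ N → a * q ^ j ≠ d) (hbcd : ∀ j ≤ N, a * q ^ j ≠ b * c * d) :
    ∑ k ∈ Finset.range (N + 1),
      jacksonTerm q a b c d (b * c * d / (a * q ^ (N + 1))) (a * q ^ (N + 1)) k =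
    (1 - a) * (qShiftedFactorial (a * q) q N * qShiftedFactorial (a * q / (b * c)) q N *
      qShiftedFactorial (a * q / (b * d)) q N * qShiftedFactorial (a * q / (c * d)) q N) /
      (qShiftedFactorial (a * q / b) q N * qShiftedFactorial (a * q / c) q N *
        qShiftedFactorial (a * q / d) q N * qShiftedFactorial (a * q / (b * c * d)) q N) := by
  induction N with
  | zero => simp [jacksonTerm, qShiftedFactorial_zero]
  | succ N ih =>
    have ih := ih (fun j h1 h2 => hab j h1 (by omega)) (fun j h1 h2 => hac j h1 (by omega))
      (fun j h1 h2 => had j h1 (by omega)) (fun j h => hbcd j (by omega))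
    obtain ⟨t, ht⟩ : ∃ t, t = a * q ^ (N + 1) := ⟨_, rfl⟩
    have ht0 : t ≠ 0 := by rw [ht]; positivity
    have hbcd0 : b * c * d ≠ 0 := mul_ne_zero (mul_ne_zero hb hc) hd
    have htq : a * q ^ (N + 1 + 1) = t * q := by rw [ht]; ring
    have hsq : b * c * d / (t * q) = b * c * d / t / q := by rw [div_div]
    -- The last factor is 1 - q^(-N) q^N = 0. This kills both the certificate and the extra term of
    -- the shorter series.
    have hz : qShiftedFactorial (a * q / t) q (N + 1) = 0 := by
      refine Finset.prod_eq_zero (Finset.self_mem_range_succ N) ?_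
      rw [ht]; field_simp; ring
    have tel := jackson_telescope (a := a) (s := b * c * d / t) hq0 hb hc hd
      (div_ne_zero hbcd0 ht0) (div_mul_cancel₀ _ ht0) (ht ▸ hab (N + 1) (by omega) le_rfl)
      (ht ▸ hac (N + 1) (by omega) le_rfl) (ht ▸ had (N + 1) (by omega) le_rfl) (N + 1)
      (fun j h _ => hq j h) hab hac had
      (fun j hj => by
        have := hbcd (N + 1 - j) (by omega)
        contrapose! this
        rw [div_mul_eq_mul_div, div_eq_one_iff_eq ht0, ht] at this
        rw [← mul_left_inj' (pow_ne_zero j hq0), this, mul_assoc, ← pow_add]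
        congr 2; omega)
      (fun j hj => by rw [ht, mul_assoc, ← pow_add]; exact haq _ (by omega))
    have hcert : jacksonCert q a b c d (b * c * d / t) t (N + 1) = 0 := by
      rw [jacksonCert, hz]; simp
    have hlast : jacksonTerm q a b c d (b * c * d / t) t (N + 1) = 0 := by
      rw [jacksonTerm, hz]; simp
    rw [← ht] at ih
    rw [hcert, Finset.sum_sub_distrib, ← Finset.mul_sum, Finset.sum_range_succ _ (N + 1),
      Finset.sum_range_succ _ (N + 1), hlast, add_zero, ih, sub_eq_zero] at tel
    rw [htq, hsq, Finset.sum_range_succ _ (N + 1), tel, jacksonRatio]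
    have am (z : K) : a * q / z * q ^ N = t / z := by rw [ht]; ring
    have am' : a * q * q ^ N = t := by rw [ht]; ring
    have r1 : b / (b * c * d / t) = t / (c * d) := by field_simp
    have r2 : c / (b * c * d / t) = t / (b * d) := by field_simp
    have r3 : d / (b * c * d / t) = t / (b * c) := by field_simp
    have r4 : 1 / (b * c * d / t) = t / (b * c * d) := by field_simp
    simp only [qShiftedFactorial_succ, am, am', r1, r2, r3, r4]
    rw [div_mul_div_comm]
    congr 1 <;> ring

end Jackson

/-! ### The deformed series and the square of its sum. -/

section Deformation

/-- The `k`-th term of the series obtained from `∑ termA q k` by replacing the fifth powers of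
`1 - q ^ (3 j + 1)` and `1 - q ^ (3 j + 3)` by symmetric products over the roots of
`(X - 1) ^ 5 - lam * X`. -/
def deformedTerm {K : Type*} [Field K] (q lam : K) (k : ℕ) : K :=
  qInteger q (6 * k + 1) *
    ((qShiftedFactorial q (q ^ 3) k *
        ∏ j ∈ Finset.range k, ((1 - q ^ (3 * j + 1)) ^ 5 - lam * (q ^ (3 * j + 1)) ^ 4)) /
      (qShiftedFactorial (q ^ 3) (q ^ 3) k *
        ∏ j ∈ Finset.range k, ((1 - q ^ (3 * j + 3)) ^ 5 + lam * q ^ (3 * j + 3)))) * q ^ (3 * k)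

/-- The quotient of `(X - 1) ^ 5 - lam * X` by `X - y`, where `lam = (y - 1) ^ 5 / y`. -/
def cofactorQuartic {K : Type*} [Field K] (y x : K) : K :=
  (x - 1) ^ 4 + (y - 1) * (x - 1) ^ 3 + (y - 1) ^ 2 * (x - 1) ^ 2 + (y - 1) ^ 3 * (x - 1) +
    (y - 1) ^ 4 - (y - 1) ^ 5 / y

/-- The product of `1 - w / (u * v)` over the six pairs `u`, `v` of roots of `cofactorQuartic y`,
expanded around `((1 - w) * (1 - w * y)) ^ 3`. -/
def pairResolvent {K : Type*} [Field K] (y w : K) : K :=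
  ((1 - w) * (1 - w * y)) ^ 3 +
    ((1 - w) * (1 - w * y)) ^ 2 * w * (2 * (y - 1) ^ 2 - (y - 1) ^ 3) +
    ((1 - w) * (1 - w * y)) * w ^ 2 * (-2 * (y - 1) ^ 4 - 4 * (y - 1) ^ 5 + (y - 1) ^ 6) +
    w ^ 3 * (-(y - 1) ^ 6 + (y - 1) ^ 8 - (y - 1) ^ 9)

variable {K : Type*} [Field K]

/-- Successive deflation: the cubic and the quadratic are the quotients by the linear factors
already found, and the last root is forced by the sum. -/
theorem exists_quartic_roots [IsAlgClosed K] (e1 e2 e3 e4 : K) :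
    ∃ u1 u2 u3 u4 : K, u1 + u2 + u3 + u4 = e1 ∧
      u1 * u2 + u1 * u3 + u1 * u4 + u2 * u3 + u2 * u4 + u3 * u4 = e2 ∧
      u1 * u2 * u3 + u1 * u2 * u4 + u1 * u3 * u4 + u2 * u3 * u4 = e3 ∧
      u1 * u2 * u3 * u4 = e4 := by
  obtain ⟨u1, h1⟩ := IsAlgClosed.exists_root
    (X ^ 4 - C e1 * X ^ 3 + C e2 * X ^ 2 - C e3 * X + C e4 : K[X]) (by
      rw [show (X ^ 4 - C e1 * X ^ 3 + C e2 * X ^ 2 - C e3 * X + C e4 : K[X]).degree = 4 by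
        compute_degree!]
      norm_num)
  obtain ⟨u2, h2⟩ := IsAlgClosed.exists_root
    (X ^ 3 - C (e1 - u1) * X ^ 2 + C (e2 - u1 * (e1 - u1)) * X -
      C (e3 - u1 * (e2 - u1 * (e1 - u1))) : K[X]) (by
      rw [show (X ^ 3 - C (e1 - u1) * X ^ 2 + C (e2 - u1 * (e1 - u1)) * X -
        C (e3 - u1 * (e2 - u1 * (e1 - u1))) : K[X]).degree = 3 by compute_degree!]
      norm_num)
  obtain ⟨u3, h3⟩ := IsAlgClosed.exists_root
    (X ^ 2 - C (e1 - u1 - u2) * X + C (e2 - u1 * (e1 - u1) - u2 * (e1 - u1 - u2)) : K[X]) (by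
      rw [show (X ^ 2 - C (e1 - u1 - u2) * X +
        C (e2 - u1 * (e1 - u1) - u2 * (e1 - u1 - u2)) : K[X]).degree = 2 by compute_degree!]
      norm_num)
  simp only [IsRoot.def, eval_add, eval_sub, eval_mul, eval_pow, eval_X, eval_C] at h1 h2 h3
  refine ⟨u1, u2, u3, e1 - u1 - u2 - u3, by ring, by linear_combination -h3, ?_, ?_⟩
  · linear_combination h2 - (u1 + u2) * h3
  · linear_combination -h1 + u1 * h2 - u1 * u2 * h3

theorem prod_one_sub_div_quartic {y u1 u2 u3 u4 x : K} (hy : y ≠ 0)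
    (h1 : u1 + u2 + u3 + u4 = 4 - (y - 1))
    (h2 : u1 * u2 + u1 * u3 + u1 * u4 + u2 * u3 + u2 * u4 + u3 * u4 =
      6 - 3 * (y - 1) + (y - 1) ^ 2)
    (h3 : u1 * u2 * u3 + u1 * u2 * u4 + u1 * u3 * u4 + u2 * u3 * u4 =
      4 - 3 * (y - 1) + 2 * (y - 1) ^ 2 - (y - 1) ^ 3)
    (h4 : u1 * u2 * u3 * u4 = 1 / y) :
    (x - u1) * (x - u2) * (x - u3) * (x - u4) = cofactorQuartic y x := by
  have e : (x - u1) * (x - u2) * (x - u3) * (x - u4) = x ^ 4 - (4 - (y - 1)) * x ^ 3 +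
      (6 - 3 * (y - 1) + (y - 1) ^ 2) * x ^ 2 -
      (4 - 3 * (y - 1) + 2 * (y - 1) ^ 2 - (y - 1) ^ 3) * x + 1 / y := by
    rw [← h1, ← h2, ← h3, ← h4]; ring
  rw [e, cofactorQuartic]
  field_simp
  ring

theorem cofactorQuartic_mul_sub {y x : K} (hy : y ≠ 0) :
    cofactorQuartic y x * (x - y) = (x - 1) ^ 5 - (y - 1) ^ 5 / y * x := by
  rw [cofactorQuartic]
  field_simp
  ring

/-- Each product over two complementary pairs is linear in t = u_i u_j + u_k u_l. The three values
of t are the roots of the cubic resolvent, so their symmetric functions are polynomials in those of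
the `u`'s. At y = 1 every t is 2 and 1 + y - y t vanishes, which is why the expansion is made around
`(1 - w) * (1 - w * y)`. -/
theorem pairResolvent_eq_prod {y u1 u2 u3 u4 w : K} (hy : y ≠ 0)
    (h1 : u1 + u2 + u3 + u4 = 4 - (y - 1))
    (h2 : u1 * u2 + u1 * u3 + u1 * u4 + u2 * u3 + u2 * u4 + u3 * u4 =
      6 - 3 * (y - 1) + (y - 1) ^ 2)
    (h3 : u1 * u2 * u3 + u1 * u2 * u4 + u1 * u3 * u4 + u2 * u3 * u4 =
      4 - 3 * (y - 1) + 2 * (y - 1) ^ 2 - (y - 1) ^ 3)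
    (h4 : u1 * u2 * u3 * u4 = 1 / y) :
    ((1 - w / (u1 * u2)) * (1 - w / (u3 * u4))) * ((1 - w / (u1 * u3)) * (1 - w / (u2 * u4))) *
      ((1 - w / (u2 * u3)) * (1 - w / (u1 * u4))) = pairResolvent y w := by
  have h0 : u1 * u2 * u3 * u4 ≠ 0 := by rw [h4]; exact one_div_ne_zero hy
  simp only [mul_ne_zero_iff] at h0
  obtain ⟨⟨⟨n1, n2⟩, n3⟩, n4⟩ := h0
  have h4' : y * (u1 * u2 * u3 * u4) = 1 := by rw [h4]; field_simp
  have pair (a b c d : K) (ha : a ≠ 0) (hb : b ≠ 0) (hc : c ≠ 0) (hd : d ≠ 0)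
      (h : y * (a * b * c * d) = 1) : (1 - w / (a * b)) * (1 - w / (c * d)) =
      (1 - w) * (1 - w * y) + w * (1 + y - y * (a * b + c * d)) := by
    field_simp
    linear_combination (-w ^ 2 + w * a * b + w * c * d) * h
  rw [pair u1 u2 u3 u4 n1 n2 n3 n4 h4',
    pair u1 u3 u2 u4 n1 n3 n2 n4 (by rw [← h4']; ring),
    pair u2 u3 u1 u4 n2 n3 n1 n4 (by rw [← h4']; ring), pairResolvent]
  generalize (1 - w) * (1 - w * y) = G at *
  have s2 : (u1 * u2 + u3 * u4) * (u1 * u3 + u2 * u4) + (u1 * u2 + u3 * u4) * (u2 * u3 + u1 * u4) +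
      (u1 * u3 + u2 * u4) * (u2 * u3 + u1 * u4) = (4 - (y - 1)) *
      (4 - 3 * (y - 1) + 2 * (y - 1) ^ 2 - (y - 1) ^ 3) - 4 * (u1 * u2 * u3 * u4) := by
    rw [← h1, ← h3]; ring
  have s3 : (u1 * u2 + u3 * u4) * (u1 * u3 + u2 * u4) * (u2 * u3 + u1 * u4) =
      (4 - 3 * (y - 1) + 2 * (y - 1) ^ 2 - (y - 1) ^ 3) ^ 2 +
      (4 - (y - 1)) ^ 2 * (u1 * u2 * u3 * u4) -
      4 * (6 - 3 * (y - 1) + (y - 1) ^ 2) * (u1 * u2 * u3 * u4) := by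
    rw [← h1, ← h2, ← h3]; ring
  have s1 : (u1 * u2 + u3 * u4) + (u1 * u3 + u2 * u4) + (u2 * u3 + u1 * u4) =
      6 - 3 * (y - 1) + (y - 1) ^ 2 := by rw [← h2]; ring
  generalize u1 * u2 * u3 * u4 = e4 at *
  generalize u1 * u2 + u3 * u4 = t1 at *
  generalize u1 * u3 + u2 * u4 = t2 at *
  generalize u2 * u3 + u1 * u4 = t3 at *
  have expand : (G + w * (1 + y - y * t1)) * (G + w * (1 + y - y * t2)) *
      (G + w * (1 + y - y * t3)) = (G + w * (1 + y)) ^ 3 -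
      (G + w * (1 + y)) ^ 2 * (w * y) * (t1 + t2 + t3) +
      (G + w * (1 + y)) * (w * y) ^ 2 * (t1 * t2 + t1 * t3 + t2 * t3) -
      (w * y) ^ 3 * (t1 * t2 * t3) := by ring
  rw [expand, s1, s2, s3]
  rw [← show (1 : K) / y = e4 from h4.symm]
  field_simp
  ring

/-- If w w' = p p', then 1 - w' / p = -(p' / w) (1 - w / p'). Reflecting one of the two copies of
the product therefore trades `p` for `p'`. -/
theorem qShiftedFactorial_sq_of_reflect {q x p p' y : K} {M : ℕ} (hx : x ≠ 0) (hq : q ≠ 0)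
    (hy : y ≠ 0) (hpp : p * p' = 1 / y) (hxy : ∀ j < M, (x * q ^ j) * (x * q ^ (M - 1 - j)) = 1 / y) :
    qShiftedFactorial (x / p) q M ^ 2 = ∏ j ∈ Finset.range M,
      (-(p' / (x * q ^ j)) * ((1 - x * q ^ j / p) * (1 - x * q ^ j / p'))) := by
  have h0 : p * p' ≠ 0 := by rw [hpp]; exact one_div_ne_zero hy
  have hp := left_ne_zero_of_mul h0
  have hp' := right_ne_zero_of_mul h0
  rw [sq]
  nth_rw 2 [qShiftedFactorial]
  rw [← Finset.prod_range_reflect, qShiftedFactorial, ← Finset.prod_mul_distrib]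
  refine Finset.prod_congr rfl fun j hj => ?_
  have h := (hxy j (Finset.mem_range.1 hj)).trans hpp.symm
  have hw : x * q ^ j ≠ 0 := mul_ne_zero hx (pow_ne_zero _ hq)
  rw [div_mul_eq_mul_div, div_mul_eq_mul_div]
  generalize x * q ^ (M - 1 - j) = w' at *
  generalize x * q ^ j = w at *
  obtain rfl : w' = p * p' / w := by field_simp; linear_combination h
  field_simp
  ring

theorem deformed_factor_eq {u1 u2 u3 u4 y x : K} (hy : y ≠ 0)
    (hp : (x - u1) * (x - u2) * (x - u3) * (x - u4) = cofactorQuartic y x) :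
    (x - u1) * (x - u2) * (x - u3) * (x - u4) * (x - y) = (x - 1) ^ 5 - (y - 1) ^ 5 / y * x := by
  rw [hp, cofactorQuartic_mul_sub hy]

/-- With P(X) = (X - 1)^5 - lam X, the product of 1 - x u over the roots is x^5 P(1/x), and that of
1 - x / u is -P(x) because the roots have product 1. The arguments `1 / u4` and `q ^ 3 / y` encode
the parameters q u4 and q y. -/
theorem jacksonTerm_eq_deformedTerm {q y u1 u2 u3 u4 : K} (hq0 : q ≠ 0) (hq1 : 1 - q ≠ 0)
    (n1 : u1 ≠ 0) (n2 : u2 ≠ 0) (n3 : u3 ≠ 0) (n4 : u4 ≠ 0) (h4 : y * (u1 * u2 * u3 * u4) = 1)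
    (hP5 : ∀ x, (x - u1) * (x - u2) * (x - u3) * (x - u4) * (x - y) =
      (x - 1) ^ 5 - (y - 1) ^ 5 / y * x) (k : ℕ) :
    jacksonTerm (q ^ 3) q (q * u1) (q * u2) (q * u3) (1 / u4) (q ^ 3 / y) k =
      (1 - q) * deformedTerm q ((y - 1) ^ 5 / y) k := by
  have hQ (j : ℕ) : (q ^ 3) ^ j = q ^ (3 * j) := (pow_mul q 3 j).symm
  have hy0 : y ≠ 0 := left_ne_zero_of_mul (h4 ▸ one_ne_zero)
  have hnum : qShiftedFactorial (q * u1) (q ^ 3) k * qShiftedFactorial (q * u2) (q ^ 3) k *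
      qShiftedFactorial (q * u3) (q ^ 3) k * qShiftedFactorial (q * u4) (q ^ 3) k *
      qShiftedFactorial (q * y) (q ^ 3) k = ∏ j ∈ Finset.range k,
        ((1 - q ^ (3 * j + 1)) ^ 5 - (y - 1) ^ 5 / y * (q ^ (3 * j + 1)) ^ 4) := by
    simp only [qShiftedFactorial, ← Finset.prod_mul_distrib]
    refine Finset.prod_congr rfl fun j _ => ?_
    have h := hP5 (1 / q ^ (3 * j + 1))
    have hs0 : q ^ (3 * j + 1) ≠ 0 := pow_ne_zero _ hq0
    have e (u : K) : 1 - q * u * (q ^ 3) ^ j =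
        q ^ (3 * j + 1) * (1 / q ^ (3 * j + 1) - u) := by
      rw [hQ, mul_sub, mul_one_div_cancel hs0, pow_succ]; ring
    simp only [e]
    generalize q ^ (3 * j + 1) = x at *
    calc _ = x ^ 5 * ((1 / x - u1) * (1 / x - u2) * (1 / x - u3) * (1 / x - u4) *
          (1 / x - y)) := by ring
      _ = _ := by rw [h]; field_simp
  have hden : qShiftedFactorial (q ^ 3 / u1) (q ^ 3) k * qShiftedFactorial (q ^ 3 / u2) (q ^ 3) k *
      qShiftedFactorial (q ^ 3 / u3) (q ^ 3) k * qShiftedFactorial (q ^ 3 / u4) (q ^ 3) k *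
      qShiftedFactorial (q ^ 3 / y) (q ^ 3) k = ∏ j ∈ Finset.range k,
        ((1 - q ^ (3 * j + 3)) ^ 5 + (y - 1) ^ 5 / y * q ^ (3 * j + 3)) := by
    simp only [qShiftedFactorial, ← Finset.prod_mul_distrib]
    refine Finset.prod_congr rfl fun j _ => ?_
    have h := hP5 (q ^ (3 * j + 3))
    have e (u : K) : 1 - q ^ 3 / u * (q ^ 3) ^ j = 1 - q ^ (3 * j + 3) / u := by
      rw [hQ, pow_add]; ring
    simp only [e]
    generalize q ^ (3 * j + 3) = x at *
    calc _ = -((x - u1) * (x - u2) * (x - u3) * (x - u4) * (x - y)) /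
          (y * (u1 * u2 * u3 * u4)) := by field_simp; ring
      _ = _ := by rw [h, h4]; ring
  have e1 (u : K) : q * q ^ 3 / (q * u) = q ^ 3 / u := by field_simp
  have e2 : q / (1 / u4) = q * u4 := by field_simp
  have e3 : q * q ^ 3 / (q ^ 3 / y) = q * y := by field_simp
  have e4 : 1 / u4 * q ^ 3 = q ^ 3 / u4 := by ring
  rw [jacksonTerm, deformedTerm, e1, e1, e1, e2, e3, e4, ← hnum, ← hden, qInteger, hQ, hQ,
    ← pow_succ', show 3 * (2 * k) + 1 = 6 * k + 1 by ring]
  have e5 (A F x : K) : (1 - q) * (A / (1 - q) * F * x) = A * F * x := by field_simp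
  rw [e5]
  ring

theorem sq_product_factor_eq {y u1 u2 u3 u4 w z : K} (n1 : u1 ≠ 0) (n2 : u2 ≠ 0) (n3 : u3 ≠ 0)
    (n4 : u4 ≠ 0) (h4' : y * (u1 * u2 * u3 * u4) = 1) (hw0 : w ≠ 0) (hz0 : z ≠ 0) :
    (-(1 - z * y) / (z * y)) ^ 2 *
        (-(u3 * u4 / w) * ((1 - w / (u1 * u2)) * (1 - w / (u3 * u4)))) *
        (-(u2 * u4 / w) * ((1 - w / (u1 * u3)) * (1 - w / (u2 * u4)))) *
        (-(u1 * u4 / w) * ((1 - w / (u2 * u3)) * (1 - w / (u1 * u4)))) /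
      ((1 - z / u1) * (1 - z / u2) * (1 - z / u3) * (-(u4 / z) * (1 - z / u4))) ^ 2 =
    -(1 - z * y) ^ 2 * ((1 - w / (u1 * u2)) * (1 - w / (u3 * u4)) *
          ((1 - w / (u1 * u3)) * (1 - w / (u2 * u4))) *
          ((1 - w / (u2 * u3)) * (1 - w / (u1 * u4)))) /
      (y ^ 5 * w ^ 3 * ((z - u1) * (z - u2) * (z - u3) * (z - u4)) ^ 2) := by
  obtain rfl : y = 1 / (u1 * u2 * u3 * u4) := by field_simp; linear_combination h4'
  have f1 (u : K) (hu : u ≠ 0) : 1 - z / u = -(z - u) / u := by field_simp; ring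
  rw [f1 u1 n1, f1 u2 n2, f1 u3 n3, f1 u4 n4]
  generalize z - u1 = a1
  generalize z - u2 = a2
  generalize z - u3 = a3
  generalize z - u4 = a4
  generalize 1 - w / (u1 * u2) = b1
  generalize 1 - w / (u1 * u3) = b2
  generalize 1 - w / (u2 * u3) = b3
  generalize 1 - w / (u1 * u4) = b4
  generalize 1 - w / (u2 * u4) = b5
  generalize 1 - w / (u3 * u4) = b6
  generalize 1 - z * (1 / (u1 * u2 * u3 * u4)) = b7
  -- If some factor vanishes, both denominators are zero and both quotients are 0 by convention.
  by_cases ha : a1 * a2 * a3 * a4 = 0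
  · simp only [mul_eq_zero] at ha
    rcases ha with ((rfl | rfl) | rfl) | rfl <;> simp
  simp only [mul_eq_zero, not_or] at ha
  obtain ⟨⟨⟨_, _⟩, _⟩, _⟩ := ha
  field_simp

theorem sq_sum_deformedTerm_of_isAlgClosed [IsAlgClosed K] {q y : K} (M : ℕ) (hq0 : q ≠ 0)
    (hq : ∀ j, 1 ≤ j → q ^ j ≠ 1) (hy : y * q ^ (3 * M + 1) = 1)
    (hF : ∀ r, 1 ≤ r → r ≤ M + 1 →
      (1 - q ^ (3 * r)) ^ 5 + (y - 1) ^ 5 / y * q ^ (3 * r) ≠ 0) :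
    (∑ k ∈ Finset.range (M + 1), deformedTerm q ((y - 1) ^ 5 / y) k) ^ 2 =
      qInteger q (3 * M + 1) ^ 2 * ∏ j ∈ Finset.range M,
        (-(1 - q ^ (3 * j + 3) * y) ^ 2 * pairResolvent y (q ^ (3 * j + 2)) /
          (y ^ 5 * (q ^ (3 * j + 2)) ^ 3 * cofactorQuartic y (q ^ (3 * j + 3)) ^ 2)) := by
  have hy0 : y ≠ 0 := left_ne_zero_of_mul (hy ▸ one_ne_zero)
  obtain ⟨u1, u2, u3, u4, h1, h2, h3, h4⟩ := exists_quartic_roots (4 - (y - 1))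
    (6 - 3 * (y - 1) + (y - 1) ^ 2) (4 - 3 * (y - 1) + 2 * (y - 1) ^ 2 - (y - 1) ^ 3) (1 / y)
  have h0 : u1 * u2 * u3 * u4 ≠ 0 := by rw [h4]; exact one_div_ne_zero hy0
  simp only [mul_ne_zero_iff] at h0
  obtain ⟨⟨⟨n1, n2⟩, n3⟩, n4⟩ := h0
  have h4' : y * (u1 * u2 * u3 * u4) = 1 := by rw [h4]; field_simp
  have hP := fun x => prod_one_sub_div_quartic (x := x) hy0 h1 h2 h3 h4
  have hP5 := fun x => deformed_factor_eq hy0 (hP x)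
  have hne (r : ℕ) (hr : 1 ≤ r) (hr' : r ≤ M + 1) : q ^ (3 * r) ≠ u1 ∧ q ^ (3 * r) ≠ u2 ∧
      q ^ (3 * r) ≠ u3 ∧ q ^ (3 * r) ≠ u4 := by
    have h := hF r hr hr'
    have h' := hP5 (q ^ (3 * r))
    refine ⟨?_, ?_, ?_, ?_⟩ <;> rintro hu <;> rw [hu] at h h' <;> apply h <;>
      linear_combination h'
  have hQ0 : q ^ 3 ≠ 0 := pow_ne_zero 3 hq0
  have hQ (j : ℕ) : (q ^ 3) ^ j = q ^ (3 * j) := (pow_mul q 3 j).symm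
  have hqi (u : K) (hu : ∀ r, 1 ≤ r → r ≤ M + 1 → q ^ (3 * r) ≠ u) (j : ℕ) (hj : 1 ≤ j)
      (hj' : j ≤ M) : q * (q ^ 3) ^ j ≠ q * u := by
    rw [hQ]; exact fun h => hu j hj (by omega) (mul_left_cancel₀ hq0 h)
  have hj := jackson_sum (q := q ^ 3) (a := q) (b := q * u1) (c := q * u2) (d := q * u3) hQ0 hq0
    (mul_ne_zero hq0 n1) (mul_ne_zero hq0 n2) (mul_ne_zero hq0 n3)
    (fun j hj => by rw [hQ]; exact hq _ (by omega))
    (fun j hj => by rw [hQ, ← pow_succ']; exact hq _ (by omega)) M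
    (hqi u1 fun r h h' => (hne r h h').1) (hqi u2 fun r h h' => (hne r h h').2.1)
    (hqi u3 fun r h h' => (hne r h h').2.2.1)
    -- As q^(3M + 1) = u1 u2 u3 u4, an equality here would make q^(3 (M + 1 - j)) equal to `u4`. The
    -- case `j = 0` is why `hF` extends to `M + 1`.
    (fun j hj h => by
      refine (hne (M + 1 - j) (by omega) (by omega)).2.2.2 ?_
      have e : q ^ (3 * (M + 1 - j)) * (q * (q ^ 3) ^ j) = q ^ 3 * q ^ (3 * M + 1) := by
        rw [hQ, ← pow_succ', ← pow_add, ← pow_add]; congr 1; omega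
      rw [h] at e
      have : q ^ 3 * (u1 * u2 * u3) ≠ 0 := by simp [*]
      apply mul_right_cancel₀ this
      have e2 : q ^ (3 * M + 1) = u1 * u2 * u3 * u4 := by
        apply mul_left_cancel₀ hy0; rw [hy, h4']
      rw [e2] at e
      linear_combination e)
  have hq1 : 1 - q ≠ 0 := sub_ne_zero.2 (by simpa using (hq 1 le_rfl).symm)
  have hn : q ^ (3 * M + 1) = 1 / y := by field_simp; linear_combination hy
  have ht : q * (q ^ 3) ^ (M + 1) = q ^ 3 / y := by
    rw [hQ, ← pow_succ', show 3 * (M + 1) + 1 = 3 + (3 * M + 1) by ring, pow_add, hn]; ring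
  have hs : q * u1 * (q * u2) * (q * u3) / (q ^ 3 / y) = 1 / u4 := by
    field_simp; linear_combination h4'
  rw [ht, hs] at hj
  simp only [jacksonTerm_eq_deformedTerm hq0 hq1 n1 n2 n3 n4 h4' hP5, ← Finset.mul_sum] at hj
  rw [mul_div_assoc] at hj
  have hj := mul_left_cancel₀ hq1 hj
  have e1 (u : K) : q * q ^ 3 / (q * u) = q ^ 3 / u := by field_simp
  have e2 (u v : K) : q * q ^ 3 / (q * u * (q * v)) = q ^ 2 / (u * v) := by
    rw [show q * q ^ 3 / (q * u * (q * v)) = q ^ 2 * (q * q) / (u * v * (q * q)) by ring,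
      mul_div_mul_right _ _ (mul_ne_zero hq0 hq0)]
  have e3 : q * q ^ 3 / (q * u1 * (q * u2) * (q * u3)) = q * (y * u4) := by
    field_simp; linear_combination -h4'
  have hzj (j : ℕ) : q ^ (3 * j + 3) ≠ 0 := pow_ne_zero _ hq0
  have hD (u : K) : qShiftedFactorial (q ^ 3 / u) (q ^ 3) M = ∏ j ∈ Finset.range M,
      (1 - q ^ (3 * j + 3) / u) := by
    refine Finset.prod_congr rfl fun j _ => ?_
    rw [hQ, pow_add]; ring
  have hrefl (j : ℕ) (hj : j < M) : q ^ (3 * (M - 1 - j)) * q = 1 / (y * q ^ (3 * j + 3)) := by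
    rw [eq_div_iff (mul_ne_zero hy0 (hzj j)), ← pow_succ]
    have : q ^ (3 * M + 1) = q ^ (3 * (M - 1 - j) + 1) * q ^ (3 * j + 3) := by
      rw [← pow_add]; congr 1; omega
    rw [← hy, this]; ring
  have hD4 : qShiftedFactorial (q * (y * u4)) (q ^ 3) M = ∏ j ∈ Finset.range M,
      (-(u4 / q ^ (3 * j + 3)) * (1 - q ^ (3 * j + 3) / u4)) := by
    rw [qShiftedFactorial, ← Finset.prod_range_reflect]
    refine Finset.prod_congr rfl fun j hj => ?_
    rw [hQ, show q * (y * u4) * q ^ (3 * (M - 1 - j)) = (q ^ (3 * (M - 1 - j)) * q) * y * u4 by ring,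
      hrefl j (Finset.mem_range.1 hj)]
    have := hzj j
    field_simp
    ring
  have hA : qShiftedFactorial q (q ^ 3) M = ∏ j ∈ Finset.range M,
      (-(1 - q ^ (3 * j + 3) * y) / (q ^ (3 * j + 3) * y)) := by
    rw [qShiftedFactorial, ← Finset.prod_range_reflect]
    refine Finset.prod_congr rfl fun j hj => ?_
    rw [hQ, mul_comm q, hrefl j (Finset.mem_range.1 hj)]
    have := hzj j
    field_simp
    ring
  -- Shifting the product by one step trades 1 - q for 1 - q^(3M + 1): this is the source of the
  -- factor [n].
  have hA' : qShiftedFactorial (q * q ^ 3) (q ^ 3) M =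
      qInteger q (3 * M + 1) * qShiftedFactorial q (q ^ 3) M := by
    rw [qInteger, div_mul_eq_mul_div, eq_div_iff hq1, mul_comm, ← qShiftedFactorial_succ',
      qShiftedFactorial_succ, hQ, ← pow_succ', mul_comm]
  have hX (p p' : K) (hpp : p * p' = 1 / y) := qShiftedFactorial_sq_of_reflect (x := q ^ 2)
    (M := M) (pow_ne_zero 2 hq0) hQ0 hy0 hpp (fun j hj => by
      rw [hQ, hQ, ← hn, ← pow_add, ← pow_add, ← pow_add]; congr 1; omega)
  rw [hj, e1, e1, e1, e2, e2, e2, e3, div_pow, mul_pow, mul_pow, mul_pow,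
    hX (u1 * u2) (u3 * u4) (by rw [← h4]; ring), hX (u1 * u3) (u2 * u4) (by rw [← h4]; ring),
    hX (u2 * u3) (u1 * u4) (by rw [← h4]; ring), hA', mul_pow, hA, hD, hD, hD, hD4]
  simp only [← Finset.prod_mul_distrib, ← Finset.prod_pow, mul_assoc (qInteger q _ ^ 2)]
  rw [mul_div_assoc]
  simp only [← Finset.prod_div_distrib]
  congr 1
  refine Finset.prod_congr rfl fun j _ => ?_
  have hw0 : q ^ (3 * j + 2) ≠ 0 := pow_ne_zero _ hq0
  have hz0 := hzj j
  rw [hQ, ← pow_add, show 2 + 3 * j = 3 * j + 2 by ring,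
    ← pairResolvent_eq_prod hy0 h1 h2 h3 h4, ← hP]
  exact sq_product_factor_eq n1 n2 n3 n4 h4' hw0 hz0

/-- Both sides are free of the auxiliary roots, so the identity descends from the algebraic closure.
-/
theorem sq_sum_deformedTerm {K : Type*} [Field K] {q y : K} (M : ℕ) (hq0 : q ≠ 0)
    (hq : ∀ j, 1 ≤ j → q ^ j ≠ 1) (hy : y * q ^ (3 * M + 1) = 1)
    (hF : ∀ r, 1 ≤ r → r ≤ M + 1 →
      (1 - q ^ (3 * r)) ^ 5 + (y - 1) ^ 5 / y * q ^ (3 * r) ≠ 0) :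
    (∑ k ∈ Finset.range (M + 1), deformedTerm q ((y - 1) ^ 5 / y) k) ^ 2 =
      qInteger q (3 * M + 1) ^ 2 * ∏ j ∈ Finset.range M,
        (-(1 - q ^ (3 * j + 3) * y) ^ 2 * pairResolvent y (q ^ (3 * j + 2)) /
          (y ^ 5 * (q ^ (3 * j + 2)) ^ 3 * cofactorQuartic y (q ^ (3 * j + 3)) ^ 2)) := by
  let φ := algebraMap K (AlgebraicClosure K)
  have hφ : Function.Injective φ := φ.injective
  have h := sq_sum_deformedTerm_of_isAlgClosed (q := φ q) (y := φ y) M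
    (by simpa using hq0) (fun j hj => by rw [← map_pow]; exact fun h => hq j hj (hφ (h.trans (map_one φ).symm)))
    (by rw [← map_pow, ← map_mul, hy, map_one])
    (fun r h1 h2 => by
      have := (map_ne_zero φ).2 (hF r h1 h2)
      simpa using this)
  have h2 : φ 2 = 2 := map_ofNat φ 2
  have h4 : φ 4 = 4 := map_ofNat φ 4
  apply hφ
  simpa [h2, h4, deformedTerm, qInteger, qShiftedFactorial, pairResolvent, cofactorQuartic] using h

end Deformation

/-! ### Congruences measured by a valuation, and the expansion of one factor. -/

section ValuationCongruence

variable {K : Type*} [Field K] {Γ₀ : Type*} [LinearOrderedCommGroupWithZero Γ₀]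

/-- `x` and `y` differ by an element of valuation at most `r`. -/
def ValCongr (v : Valuation K Γ₀) (r : Γ₀) (x y : K) : Prop :=
  v (x - y) ≤ r

namespace ValCongr

variable {v : Valuation K Γ₀} {r s : Γ₀} {x y z x' y' : K}

theorem refl (v : Valuation K Γ₀) (r : Γ₀) (x : K) : ValCongr v r x x := by
  simp [ValCongr]

theorem symm (h : ValCongr v r x y) : ValCongr v r y x := by
  rwa [ValCongr, Valuation.map_sub_swap]

theorem trans (h : ValCongr v r x y) (h' : ValCongr v r y z) : ValCongr v r x z := by
  rw [ValCongr, ← sub_add_sub_cancel x y z]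
  exact v.map_add_le h h'

theorem mono (h : ValCongr v r x y) (hrs : r ≤ s) : ValCongr v s x y :=
  le_trans h hrs

theorem add (h : ValCongr v r x y) (h' : ValCongr v r x' y') :
    ValCongr v r (x + x') (y + y') := by
  rw [ValCongr, add_sub_add_comm]
  exact v.map_add_le h h'

theorem sum {ι : Type*} {t : Finset ι} {f g : ι → K} (h : ∀ i ∈ t, ValCongr v r (f i) (g i)) :
    ValCongr v r (∑ i ∈ t, f i) (∑ i ∈ t, g i) := by
  rw [ValCongr, ← Finset.sum_sub_distrib]
  exact v.map_sum_le h

theorem le_one (h : ValCongr v r x y) (hr : r ≤ 1) (hx : v x ≤ 1) : v y ≤ 1 := by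
  rw [← sub_sub_cancel x y]
  exact v.map_sub_le hx (le_trans h hr)

theorem mul (h : ValCongr v r x y) (h' : ValCongr v r x' y') (hx : v x ≤ 1) (hy' : v y' ≤ 1) :
    ValCongr v r (x * x') (y * y') := by
  rw [ValCongr, show x * x' - y * y' = x * (x' - y') + (x - y) * y' by ring]
  refine v.map_add_le ?_ ?_
  · rw [map_mul]; exact (mul_le_of_le_one_left' hx).trans h'
  · rw [map_mul]; exact (mul_le_of_le_one_right' hy').trans h

theorem mul_left (h : ValCongr v r x y) (hz : v z ≤ 1) : ValCongr v r (z * x) (z * y) := by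
  rw [ValCongr, ← mul_sub, map_mul]
  exact (mul_le_of_le_one_left' hz).trans h

theorem prod {ι : Type*} {t : Finset ι} {f g : ι → K} (h : ∀ i ∈ t, ValCongr v r (f i) (g i))
    (hf : ∀ i ∈ t, v (f i) ≤ 1) (hg : ∀ i ∈ t, v (g i) ≤ 1) :
    ValCongr v r (∏ i ∈ t, f i) (∏ i ∈ t, g i) := by
  classical
  induction t using Finset.induction_on with
  | empty => simpa using refl v r 1
  | insert i t hi ih =>
    rw [Finset.prod_insert hi, Finset.prod_insert hi]
    refine mul (h i (by simp)) (ih (fun j hj => h j (by simp [hj])) (fun j hj => hf j (by simp [hj]))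
      (fun j hj => hg j (by simp [hj]))) (hf i (by simp)) ?_
    rw [map_prod]
    exact Finset.prod_le_one' fun j hj => hg j (by simp [hj])

theorem div (h : ValCongr v r x y) (h' : ValCongr v r x' y') (hx : v x ≤ 1) (hx' : v x' = 1)
    (hy' : v y' = 1) : ValCongr v r (x / x') (y / y') := by
  have h1 : x' ≠ 0 := by rintro rfl; simp at hx'
  have h2 : y' ≠ 0 := by rintro rfl; simp at hy'
  rw [ValCongr, show x / x' - y / y' = (x * (y' - x') + (x - y) * x') / (x' * y') by
    field_simp; ring, map_div₀, map_mul _ x', hx', hy', one_mul, div_one]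
  refine v.map_add_le ?_ ?_
  · rw [map_mul, Valuation.map_sub_swap]; exact (mul_le_of_le_one_left' hx).trans h'
  · rw [map_mul, hx', mul_one]; exact h

/-- Every neglected term contains at least two small factors. -/
theorem prod_one_add {ι : Type*} {t : Finset ι} {f : ι → K} (hr : r ≤ 1)
    (h : ∀ i ∈ t, v (f i) ≤ r) :
    ValCongr v (r ^ 2) (∏ i ∈ t, (1 + f i)) (1 + ∑ i ∈ t, f i) := by
  classical
  induction t using Finset.induction_on with
  | empty => simpa using refl v (r ^ 2) 1
  | insert i t hi ih =>
    have ih := ih fun j hj => h j (by simp [hj])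
    have hs : v (∑ j ∈ t, f j) ≤ r := v.map_sum_le fun j hj => h j (by simp [hj])
    have hi' := h i (by simp)
    rw [Finset.prod_insert hi, Finset.sum_insert hi]
    refine (mul_left ih (z := 1 + f i) (v.map_add_le (by simp) (hi'.trans hr))).trans ?_
    rw [ValCongr, show (1 + f i) * (1 + ∑ j ∈ t, f j) - (1 + (f i + ∑ j ∈ t, f j)) =
      f i * ∑ j ∈ t, f j by ring, map_mul, sq]
    exact mul_le_mul' hi' hs

end ValCongr

theorem Valuation.map_eq_one_of_sub_lt {v : Valuation K Γ₀} {x y : K} (hx : v x = 1)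
    (h : v (y - x) < 1) : v y = 1 := by
  rw [← hx]; exact v.map_eq_of_sub_lt (by rwa [hx])

theorem Valuation.map_ofNat_le_one (v : Valuation K Γ₀) (n : ℕ) [n.AtLeastTwo] :
    v (OfNat.ofNat n : K) ≤ 1 :=
  (ofNat_mem v.integer n : _)

theorem ne_zero_of_val_eq_one {v : Valuation K Γ₀} {x : K} (h : v x = 1) : x ≠ 0 := by
  rintro rfl; simp at h

/-- Congruence of the product side, one factor at a time. -/
theorem factor_congr {v : Valuation K Γ₀} {r : Γ₀} (hr : r < 1) {y w z : K} (hy : v y = 1)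
    (hε : v (y - 1) ≤ r) (hw : v w = 1) (hz : v z = 1) (hw1 : v (1 - w) = 1)
    (hz1 : v (1 - z) = 1) :
    ValCongr v (r ^ 4)
      (-(1 - z * y) ^ 2 * pairResolvent y w / (y ^ 5 * w ^ 3 * cofactorQuartic y z ^ 2))
      (-((1 - w) * (1 - w * y)) ^ 3 / ((w * y) ^ 3 * (1 - z) ^ 6) *
        (1 + (w * (2 * (y - 1) ^ 2 - (y - 1) ^ 3) / ((1 - w) * (1 - w * y)) -
          2 * (z * (y - 1) ^ 2 / (y * (1 - z) ^ 2))))) := by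
  have hr' := hr.le
  have hε1 : v (y - 1) ≤ 1 := hε.trans hr'
  have hwy : v (1 - w * y) = 1 := Valuation.map_eq_one_of_sub_lt hw1 (by
    rw [show 1 - w * y - (1 - w) = -(w * (y - 1)) by ring, Valuation.map_neg, map_mul, hw, one_mul]
    exact hε.trans_lt hr)
  have hz1' : v (z - 1) = 1 := by rw [Valuation.map_sub_swap, hz1]
  have hzy : v (z - y) = 1 := Valuation.map_eq_one_of_sub_lt hz1' (by
    rw [sub_sub_sub_cancel_left, Valuation.map_sub_swap]
    exact hε.trans_lt hr)
  have n1 := ne_zero_of_val_eq_one hy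
  have n2 := ne_zero_of_val_eq_one hw
  have n3 := ne_zero_of_val_eq_one hz1
  have n4 := ne_zero_of_val_eq_one hw1
  have n5 := ne_zero_of_val_eq_one hwy
  have n6 := ne_zero_of_val_eq_one hzy
  have my : y ∈ v.integer := hy.le
  have mw : w ∈ v.integer := hw.le
  have mz : z ∈ v.integer := hz.le
  have hlam : v ((y - 1) ^ 5 / y * z) ≤ r ^ 5 := by
    rw [map_mul, map_div₀, map_pow, hy, hz, div_one, mul_one]
    exact pow_le_pow_left' hε 5
  have hF : v ((1 - z) ^ 5 + (y - 1) ^ 5 / y * z) = 1 :=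
    Valuation.map_eq_one_of_sub_lt (x := (1 - z) ^ 5) (by rw [map_pow, hz1, one_pow]) (by
      rw [add_sub_cancel_left]
      exact hlam.trans_lt (pow_lt_one' hr (by norm_num)))
  have hPF := cofactorQuartic_mul_sub (x := z) n1
  have n7 := ne_zero_of_val_eq_one hF
  have hP0 : cofactorQuartic y z ≠ 0 := by
    intro h
    rw [h, zero_mul] at hPF
    apply n7
    linear_combination hPF
  -- Multiplying through by `z - y` turns the numerator into y (1 - z)^2 - z (y - 1)^2, with no
  -- linear term in y - 1, and completes the quartic to the quintic, which is (1 - z)^5 up to order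
  -- (y - 1)^5.
  have hB : (1 - z * y) / (y * cofactorQuartic y z) =
      ((1 - z) ^ 2 - z * (y - 1) ^ 2 / y) / ((1 - z) ^ 5 + (y - 1) ^ 5 / y * z) := by
    rw [div_eq_div_iff (mul_ne_zero n1 hP0) n7]
    apply mul_right_cancel₀ n6
    have e : ((1 - z) ^ 2 - z * (y - 1) ^ 2 / y) * y = -((1 - z * y) * (z - y)) := by
      field_simp; ring
    linear_combination -cofactorQuartic y z * (z - y) * e + (1 - z * y) * (z - y) * hPF
  have hb : v (z * (y - 1) ^ 2 / (y * (1 - z) ^ 2)) ≤ r ^ 2 := by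
    rw [map_div₀, map_mul, map_mul, map_pow, map_pow, hy, hz, hz1, one_pow, one_mul, one_mul,
      div_one]
    exact pow_le_pow_left' hε 2
  have ha : v (w * (2 * (y - 1) ^ 2 - (y - 1) ^ 3) / ((1 - w) * (1 - w * y))) ≤ r ^ 2 := by
    rw [show w * (2 * (y - 1) ^ 2 - (y - 1) ^ 3) = (y - 1) ^ 2 * (w * (2 - (y - 1))) by ring,
      map_div₀, map_mul, map_mul _ (1 - w), hw1, hwy, one_mul, div_one, map_pow]
    refine (mul_le_of_le_one_right' ?_).trans (pow_le_pow_left' hε 2)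
    exact show _ ∈ v.integer by
      repeat' first
        | assumption | exact one_mem _ | exact ofNat_mem _ _ | apply sub_mem | apply add_mem
        | apply mul_mem
  have hr2 : r ^ 2 ≤ 1 := pow_le_one' hr' 2
  have hBB : ValCongr v (r ^ 4) ((1 - z * y) / (y * cofactorQuartic y z))
      ((1 - z * (y - 1) ^ 2 / (y * (1 - z) ^ 2)) / (1 - z) ^ 3) := by
    rw [hB, show (1 - z * (y - 1) ^ 2 / (y * (1 - z) ^ 2)) / (1 - z) ^ 3 =
      ((1 - z) ^ 2 - z * (y - 1) ^ 2 / y) / (1 - z) ^ 5 by field_simp]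
    refine ValCongr.div (.refl _ _ _) ?_ ?_ hF (by rw [map_pow, hz1, one_pow])
    · rw [ValCongr, add_sub_cancel_left]
      exact hlam.trans (pow_le_pow_right_of_le_one' hr' (by norm_num))
    · refine v.map_sub_le (by rw [map_pow, hz1, one_pow]) ?_
      rw [map_div₀, hy, div_one]
      exact show _ ∈ v.integer by
        repeat' first
        | assumption | exact one_mem _ | exact ofNat_mem _ _ | apply sub_mem | apply add_mem
        | apply mul_mem | apply pow_mem
  have hB1 : v ((1 - z * (y - 1) ^ 2 / (y * (1 - z) ^ 2)) / (1 - z) ^ 3) ≤ 1 := by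
    rw [map_div₀, map_pow, hz1, one_pow, div_one]
    exact v.map_sub_le (by simp) (hb.trans hr2)
  have hr4 : r ^ 4 ≤ 1 := pow_le_one' hr' 4
  have hB2 := hBB.symm.le_one hr4 hB1
  have hA1 : v (-((1 - w) * (1 - w * y)) ^ 3 / (w * y) ^ 3) = 1 := by
    rw [map_div₀, Valuation.map_neg, map_pow, map_pow, map_mul, map_mul, hw1, hwy, hw, hy]
    simp
  -- The terms of `pairResolvent` after the second are divisible by (y - 1)^4.
  have hA : ValCongr v (r ^ 4) (-pairResolvent y w / (w * y) ^ 3)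
      (-((1 - w) * (1 - w * y)) ^ 3 / (w * y) ^ 3 *
        (1 + w * (2 * (y - 1) ^ 2 - (y - 1) ^ 3) / ((1 - w) * (1 - w * y)))) := by
    have e : -pairResolvent y w / (w * y) ^ 3 - -((1 - w) * (1 - w * y)) ^ 3 / (w * y) ^ 3 *
        (1 + w * (2 * (y - 1) ^ 2 - (y - 1) ^ 3) / ((1 - w) * (1 - w * y))) =
        (y - 1) ^ 4 * -((1 - w) * (1 - w * y) * w ^ 2 * (-2 - 4 * (y - 1) + (y - 1) ^ 2) +
          w ^ 3 * (-(y - 1) ^ 2 + (y - 1) ^ 4 - (y - 1) ^ 5)) / (w * y) ^ 3 := by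
      rw [pairResolvent]
      generalize 1 - w * y = g at *
      generalize 1 - w = f at *
      field_simp
      ring
    rw [ValCongr, e, map_div₀, map_pow v (w * y), map_mul v w, hw, hy, map_mul, map_pow]
    simp only [mul_one, one_pow, div_one]
    refine (mul_le_of_le_one_right' ?_).trans (pow_le_pow_left' hε 4)
    exact show _ ∈ v.integer by
      repeat' first
        | assumption | exact one_mem _ | exact ofNat_mem _ _ | apply sub_mem | apply add_mem
        | apply mul_mem | apply pow_mem | apply neg_mem
  have h1 := hA.mul (hBB.mul hBB hB2 hB1) (hA.symm.le_one hr4 (by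
    rw [map_mul, hA1, one_mul]
    exact v.map_add_le (by simp) (ha.trans hr2))) (by rw [map_mul]; exact mul_le_one' hB1 hB1)
  have e1 : -(1 - z * y) ^ 2 * pairResolvent y w /
      (y ^ 5 * w ^ 3 * cofactorQuartic y z ^ 2) = -pairResolvent y w / (w * y) ^ 3 *
      ((1 - z * y) / (y * cofactorQuartic y z) * ((1 - z * y) / (y * cofactorQuartic y z))) := by
    field_simp
  rw [e1]
  refine h1.trans ?_
  generalize hgb : z * (y - 1) ^ 2 / (y * (1 - z) ^ 2) = b at *
  generalize hga : w * (2 * (y - 1) ^ 2 - (y - 1) ^ 3) / ((1 - w) * (1 - w * y)) = a at *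
  have e2 : -((1 - w) * (1 - w * y)) ^ 3 / (w * y) ^ 3 * (1 + a) *
      ((1 - b) / (1 - z) ^ 3 * ((1 - b) / (1 - z) ^ 3)) =
      (-((1 - w) * (1 - w * y)) ^ 3 / (w * y) ^ 3 / (1 - z) ^ 6) * ((1 + a) * (1 - b) ^ 2) := by
    field_simp
  rw [e2, ← div_div]
  refine ValCongr.mul_left ?_ (by rw [map_div₀, hA1, map_pow, hz1]; simp)
  rw [ValCongr, show (1 + a) * (1 - b) ^ 2 - (1 + (a - 2 * b)) = b * (b - 2 * a + a * b) by ring,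
    map_mul, show r ^ 4 = r ^ 2 * r ^ 2 by rw [← pow_add]]
  refine mul_le_mul' hb (v.map_add_le (v.map_sub_le hb ?_) ?_)
  · rw [map_mul]; exact (mul_le_of_le_one_left' (v.map_ofNat_le_one 2)).trans ha
  · rw [map_mul]; exact (mul_le_of_le_one_right' (hb.trans hr2)).trans ha

/-- The new form involves only x / (1 - x)^2, which is invariant under x ↦ 1/x, so that reflection
can merge the terms in `w` and `w * y`. For y = q^(-n) the coefficient is (1 - q^n)^2 (2 - q^n). -/
theorem coefficient_congr {v : Valuation K Γ₀} {r : Γ₀} (hr : r < 1) {y w z : K} (hy : v y = 1)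
    (hε : v (y - 1) ≤ r) (hw : v w = 1) (hz : v z = 1) (hw1 : v (1 - w) = 1)
    (hz1 : v (1 - z) = 1) :
    ValCongr v (r ^ 4)
      (w * (2 * (y - 1) ^ 2 - (y - 1) ^ 3) / ((1 - w) * (1 - w * y)) -
          2 * (z * (y - 1) ^ 2 / (y * (1 - z) ^ 2)))
      ((1 - 1 / y) ^ 2 * (2 - 1 / y) *
        (w / (1 - w) ^ 2 + w * y / (1 - w * y) ^ 2 - 2 * (z / (1 - z) ^ 2))) := by
  have hwy : v (1 - w * y) = 1 := Valuation.map_eq_one_of_sub_lt hw1 (by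
    rw [show 1 - w * y - (1 - w) = -(w * (y - 1)) by ring, Valuation.map_neg, map_mul, hw, one_mul]
    exact hε.trans_lt hr)
  have n1 := ne_zero_of_val_eq_one hy
  have n2 := ne_zero_of_val_eq_one hw1
  have n3 := ne_zero_of_val_eq_one hz1
  have n4 := ne_zero_of_val_eq_one hwy
  have e : (w * (2 * (y - 1) ^ 2 - (y - 1) ^ 3) / ((1 - w) * (1 - w * y)) -
          2 * (z * (y - 1) ^ 2 / (y * (1 - z) ^ 2))) - ((1 - 1 / y) ^ 2 * (2 - 1 / y) *
        (w / (1 - w) ^ 2 + w * y / (1 - w * y) ^ 2 - 2 * (z / (1 - z) ^ 2))) =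
      (y - 1) ^ 4 * (w * (1 - (y - 1) - 3 * w - (y - 1) * w + 3 * (y - 1) ^ 2 * w + w ^ 2 -
        2 * (y - 1) ^ 2 * w ^ 2 - (y - 1) ^ 2 + (y - 1) ^ 3 * w - (y - 1) ^ 3 * w ^ 2) /
        (y ^ 3 * ((1 - w) * (1 - w * y)) ^ 2) - 2 * z / (y ^ 3 * (1 - z) ^ 2)) := by
    have a1 : w * (2 * (y - 1) ^ 2 - (y - 1) ^ 3) / ((1 - w) * (1 - w * y)) -
        (1 - 1 / y) ^ 2 * (2 - 1 / y) * (w / (1 - w) ^ 2 + w * y / (1 - w * y) ^ 2) =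
      (y - 1) ^ 4 * (w * (1 - (y - 1) - 3 * w - (y - 1) * w + 3 * (y - 1) ^ 2 * w + w ^ 2 -
        2 * (y - 1) ^ 2 * w ^ 2 - (y - 1) ^ 2 + (y - 1) ^ 3 * w - (y - 1) ^ 3 * w ^ 2) /
        (y ^ 3 * ((1 - w) * (1 - w * y)) ^ 2)) := by
      field_simp
      ring
    have a2 : z * (y - 1) ^ 2 / (y * (1 - z) ^ 2) - (1 - 1 / y) ^ 2 * (2 - 1 / y) *
        (z / (1 - z) ^ 2) = (y - 1) ^ 4 * (z / (y ^ 3 * (1 - z) ^ 2)) := by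
      field_simp
      ring
    linear_combination a1 - 2 * a2
  rw [ValCongr, e, map_mul, map_pow]
  refine (mul_le_of_le_one_right' ?_).trans (pow_le_pow_left' hε 4)
  have my : y ∈ v.integer := hy.le
  have mw : w ∈ v.integer := hw.le
  have mz : z ∈ v.integer := hz.le
  refine v.map_sub_le ?_ ?_
  · rw [map_div₀, map_mul v (y ^ 3), map_pow, map_pow, map_mul v (1 - w), hy, hw1, hwy]
    simp only [one_pow, mul_one, div_one]
    exact show _ ∈ v.integer by
      repeat' first
        | assumption | exact one_mem _ | exact ofNat_mem _ _ | apply sub_mem | apply add_mem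
        | apply mul_mem | apply pow_mem
  · rw [map_div₀, map_mul v (y ^ 3), map_pow, map_pow, hy, hz1]
    simp only [one_pow, mul_one, div_one]
    exact show _ ∈ v.integer by
      repeat' first
        | assumption | exact one_mem _ | exact ofNat_mem _ _ | apply sub_mem | apply add_mem
        | apply mul_mem

end ValuationCongruence

/-! ### The supercongruence for an abstract valuation. -/

section Supercongruence

variable {K : Type*} [Field K] {Γ₀ : Type*} [LinearOrderedCommGroupWithZero Γ₀]
  {v : Valuation K Γ₀} {r : Γ₀} {q y : K} {M : ℕ}

theorem prod_factor_congr (hr : r < 1) (hvq : v q = 1)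
    (hU : ∀ i, ¬ 3 * M + 1 ∣ i → v (1 - q ^ i) = 1) (hy : y * q ^ (3 * M + 1) = 1)
    (hε : v (y - 1) ≤ r) :
    ValCongr v (r ^ 4)
      (∏ j ∈ Finset.range M, (-(1 - q ^ (3 * j + 3) * y) ^ 2 * pairResolvent y (q ^ (3 * j + 2)) /
          (y ^ 5 * (q ^ (3 * j + 2)) ^ 3 * cofactorQuartic y (q ^ (3 * j + 3)) ^ 2)))
      ((∏ j ∈ Finset.range M, (1 - q ^ (3 * j + 2)) ^ 6 / (1 - q ^ (3 * j + 3)) ^ 6) *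
        (1 + 2 * ((1 - 1 / y) ^ 2 * (2 - 1 / y)) * ∑ j ∈ Finset.range M,
          (q ^ (3 * j + 2) / (1 - q ^ (3 * j + 2)) ^ 2 -
            q ^ (3 * j + 3) / (1 - q ^ (3 * j + 3)) ^ 2))) := by
  have hr' := hr.le
  have hvp (i : ℕ) : v (q ^ i) = 1 := by rw [map_pow, hvq, one_pow]
  have hvy : v y = 1 := by
    have := congrArg v hy
    rwa [map_mul, hvp, mul_one, map_one] at this
  have hq0 := ne_zero_of_val_eq_one hvq
  have hy0 := ne_zero_of_val_eq_one hvy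
  have hw1 (j : ℕ) (hj : j ∈ Finset.range M) : v (1 - q ^ (3 * j + 2)) = 1 :=
    hU _ (Nat.not_dvd_of_pos_of_lt (by omega) (by have := Finset.mem_range.1 hj; omega))
  have hz1 (j : ℕ) (hj : j ∈ Finset.range M) : v (1 - q ^ (3 * j + 3)) = 1 :=
    hU _ (Nat.not_dvd_of_pos_of_lt (by omega) (by have := Finset.mem_range.1 hj; omega))
  have hwy (j : ℕ) (hj : j ∈ Finset.range M) : v (1 - q ^ (3 * j + 2) * y) = 1 :=
    Valuation.map_eq_one_of_sub_lt (hw1 j hj) (by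
      rw [show 1 - q ^ (3 * j + 2) * y - (1 - q ^ (3 * j + 2)) = -(q ^ (3 * j + 2) * (y - 1)) by
        ring, Valuation.map_neg, map_mul, hvp, one_mul]
      exact hε.trans_lt hr)
  have hrefl (j : ℕ) (hj : j ∈ Finset.range M) :
      q ^ (3 * (M - 1 - j) + 2) = 1 / (q ^ (3 * j + 2) * y) := by
    have hj := Finset.mem_range.1 hj
    rw [eq_div_iff (mul_ne_zero (pow_ne_zero _ hq0) hy0), ← mul_assoc, ← pow_add, mul_comm, ← hy]
    congr 2; omega
  have hG1 : ∀ j ∈ Finset.range M, v (-((1 - q ^ (3 * j + 2)) * (1 - q ^ (3 * j + 2) * y)) ^ 3 /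
      ((q ^ (3 * j + 2) * y) ^ 3 * (1 - q ^ (3 * j + 3)) ^ 6)) = 1 := by
    intro j hj
    rw [map_div₀, Valuation.map_neg, map_pow, map_mul, map_mul, map_pow, map_pow v (1 - _),
      map_mul, hw1 j hj, hwy j hj, hz1 j hj, hvp, hvy]
    simp
  have ha : ∀ j ∈ Finset.range M, v (q ^ (3 * j + 2) * (2 * (y - 1) ^ 2 - (y - 1) ^ 3) /
      ((1 - q ^ (3 * j + 2)) * (1 - q ^ (3 * j + 2) * y)) -
      2 * (q ^ (3 * j + 3) * (y - 1) ^ 2 / (y * (1 - q ^ (3 * j + 3)) ^ 2))) ≤ r ^ 2 := by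
    intro j hj
    refine v.map_sub_le ?_ ?_
    · rw [show q ^ (3 * j + 2) * (2 * (y - 1) ^ 2 - (y - 1) ^ 3) =
        (y - 1) ^ 2 * (q ^ (3 * j + 2) * (2 - (y - 1))) by ring, map_div₀, map_mul,
        map_mul v (1 - _), hw1 j hj, hwy j hj, one_mul, div_one, map_pow]
      refine (mul_le_of_le_one_right' ?_).trans (pow_le_pow_left' hε 2)
      rw [map_mul, hvp, one_mul]
      exact v.map_sub_le (v.map_ofNat_le_one 2) (hε.trans hr')
    · rw [map_mul, map_div₀, map_mul v (q ^ _), map_mul, map_pow v (y - 1), map_pow v (1 - _), hvp,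
        hvy, hz1 j hj]
      simp only [one_pow, one_mul, div_one]
      exact (mul_le_of_le_one_left' (v.map_ofNat_le_one 2)).trans (pow_le_pow_left' hε 2)
  have hr2 : r ^ 2 ≤ 1 := pow_le_one' hr' 2
  have hr4 : r ^ 4 ≤ 1 := pow_le_one' hr' 4
  have hfac := fun j hj => factor_congr hr hvy hε (hvp (3 * j + 2)) (hvp (3 * j + 3)) (hw1 j hj)
    (hz1 j hj)
  have hright : ∀ j ∈ Finset.range M, v (-((1 - q ^ (3 * j + 2)) * (1 - q ^ (3 * j + 2) * y)) ^ 3 /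
      ((q ^ (3 * j + 2) * y) ^ 3 * (1 - q ^ (3 * j + 3)) ^ 6) *
      (1 + (q ^ (3 * j + 2) * (2 * (y - 1) ^ 2 - (y - 1) ^ 3) /
      ((1 - q ^ (3 * j + 2)) * (1 - q ^ (3 * j + 2) * y)) -
      2 * (q ^ (3 * j + 3) * (y - 1) ^ 2 / (y * (1 - q ^ (3 * j + 3)) ^ 2))))) ≤ 1 := by
    intro j hj
    rw [map_mul, hG1 j hj, one_mul]
    exact v.map_add_le (by simp) ((ha j hj).trans hr2)
  refine (ValCongr.prod hfac (fun j hj => (hfac j hj).symm.le_one hr4 (hright j hj)) hright).trans ?_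
  rw [Finset.prod_mul_distrib]
  -- An equality of whole products, not of factors: reflection turns the product of 1 - w y into
  -- that of -(1 - w) / w, and the leftover powers cancel.
  have hc : ∏ j ∈ Finset.range M, (-((1 - q ^ (3 * j + 2)) * (1 - q ^ (3 * j + 2) * y)) ^ 3 /
      ((q ^ (3 * j + 2) * y) ^ 3 * (1 - q ^ (3 * j + 3)) ^ 6)) =
      ∏ j ∈ Finset.range M, (1 - q ^ (3 * j + 2)) ^ 6 / (1 - q ^ (3 * j + 3)) ^ 6 := by
    have c1 : ∏ j ∈ Finset.range M, (1 - q ^ (3 * j + 2) * y) =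
        ∏ j ∈ Finset.range M, (-(1 - q ^ (3 * j + 2)) / q ^ (3 * j + 2)) := by
      rw [← Finset.prod_range_reflect]
      refine Finset.prod_congr rfl fun j hj => ?_
      rw [hrefl j hj]
      have := pow_ne_zero (3 * j + 2) hq0
      field_simp
      ring
    have c2 : ∏ j ∈ Finset.range M, (q ^ (3 * j + 2) * q ^ (3 * j + 2) * y) = 1 := by
      rw [Finset.prod_mul_distrib, Finset.prod_mul_distrib]
      nth_rw 2 [← Finset.prod_range_reflect]
      rw [← Finset.prod_mul_distrib, ← Finset.prod_mul_distrib]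
      refine Finset.prod_eq_one fun j hj => ?_
      rw [hrefl j hj]
      have := pow_ne_zero (3 * j + 2) hq0
      field_simp
    calc _ = (∏ j ∈ Finset.range M, (1 - q ^ (3 * j + 2) * y)) ^ 3 *
          ∏ j ∈ Finset.range M, (-(1 - q ^ (3 * j + 2)) ^ 3 /
            ((q ^ (3 * j + 2) * y) ^ 3 * (1 - q ^ (3 * j + 3)) ^ 6)) := by
          rw [← Finset.prod_pow, ← Finset.prod_mul_distrib]
          refine Finset.prod_congr rfl fun j _ => ?_
          ring
      _ = (∏ j ∈ Finset.range M, (1 - q ^ (3 * j + 2)) ^ 6 / (1 - q ^ (3 * j + 3)) ^ 6) /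
          (∏ j ∈ Finset.range M, (q ^ (3 * j + 2) * q ^ (3 * j + 2) * y)) ^ 3 := by
          rw [c1, ← Finset.prod_pow, ← Finset.prod_pow, ← Finset.prod_mul_distrib,
            ← Finset.prod_div_distrib]
          refine Finset.prod_congr rfl fun j hj => ?_
          have h1 := pow_ne_zero (3 * j + 2) hq0
          have h2 := ne_zero_of_val_eq_one (hz1 j hj)
          generalize q ^ (3 * j + 2) = w at *
          generalize 1 - q ^ (3 * j + 3) = z at *
          generalize 1 - w = w1 at *
          field_simp
      _ = _ := by rw [c2, one_pow, div_one]
  rw [hc]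
  refine ValCongr.mul_left ?_ (by
    rw [← hc, map_prod]
    exact (Finset.prod_eq_one hG1).le)
  have h1 := ValCongr.prod_one_add hr2 ha
  rw [← pow_mul] at h1
  refine h1.trans (.add (.refl _ _ _) ?_)
  have h2 : ValCongr v (r ^ 4) _ _ := ValCongr.sum fun j (hj : j ∈ Finset.range M) =>
    coefficient_congr hr hvy hε (hvp (3 * j + 2)) (hvp (3 * j + 3)) (hw1 j hj) (hz1 j hj)
  refine h2.trans (?_ : ValCongr v _ _ _)
  rw [← Finset.mul_sum]
  -- Reflection sends w y to 1 / w and x / (1 - x)^2 is unchanged; this produces the overall factor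
  -- 2.
  have hs : ∑ j ∈ Finset.range M, q ^ (3 * j + 2) * y / (1 - q ^ (3 * j + 2) * y) ^ 2 =
      ∑ j ∈ Finset.range M, q ^ (3 * j + 2) / (1 - q ^ (3 * j + 2)) ^ 2 := by
    rw [← Finset.sum_range_reflect]
    refine Finset.sum_congr rfl fun j hj => ?_
    rw [hrefl j hj]
    have h1 := pow_ne_zero (3 * j + 2) hq0
    have h2 := ne_zero_of_val_eq_one (hw1 j hj)
    generalize q ^ (3 * j + 2) = w at *
    have h3 : 1 - 1 / (w * y) * y = -(1 - w) / w := by field_simp; ring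
    rw [h3]
    generalize 1 - w = w1 at *
    field_simp
  rw [Finset.sum_sub_distrib, Finset.sum_add_distrib, hs, ← Finset.mul_sum, Finset.sum_sub_distrib]
  convert ValCongr.refl v _ _ using 1
  ring

theorem val_qInteger_le_one (hM : 1 ≤ M) (hvq : v q = 1)
    (hU : ∀ i, ¬ 3 * M + 1 ∣ i → v (1 - q ^ i) = 1) (s : ℕ) : v (qInteger q s) ≤ 1 := by
  have h1 : v (1 - q) = 1 := by
    simpa using hU 1 (Nat.not_dvd_of_pos_of_lt one_pos (by omega))
  rw [qInteger, map_div₀, h1, div_one]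
  exact v.map_sub_le (by simp) (by rw [map_pow, hvq, one_pow])

theorem qShiftedFactorial_q_cube {K : Type*} [Field K] (q : K) (i k : ℕ) :
    qShiftedFactorial (q ^ i) (q ^ 3) k = ∏ j ∈ Finset.range k, (1 - q ^ (3 * j + i)) := by
  refine Finset.prod_congr rfl fun j _ => ?_
  rw [← pow_mul, ← pow_add, add_comm]

theorem val_qShiftedFactorial_le_one (hvq : v q = 1) (i k : ℕ) :
    v (qShiftedFactorial (q ^ i) (q ^ 3) k) ≤ 1 := by
  rw [qShiftedFactorial_q_cube, map_prod]
  exact Finset.prod_le_one' fun j _ => v.map_sub_le (by simp) (by rw [map_pow, hvq, one_pow])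

theorem not_dvd_three_mul {M i : ℕ} (hi : 1 ≤ i) (hi' : i < 3 * M + 1) : ¬ 3 * M + 1 ∣ 3 * i := by
  intro h
  have hc : Nat.Coprime (3 * M + 1) 3 := by
    rw [Nat.coprime_comm]
    simp
  exact Nat.not_dvd_of_pos_of_lt hi hi' (hc.dvd_of_dvd_mul_left h)

theorem val_qShiftedFactorial_cube_eq_one (hU : ∀ i, ¬ 3 * M + 1 ∣ i → v (1 - q ^ i) = 1) {k : ℕ}
    (hk : k < 3 * M + 1) : v (qShiftedFactorial (q ^ 3) (q ^ 3) k) = 1 := by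
  rw [qShiftedFactorial_q_cube, map_prod]
  refine Finset.prod_eq_one fun j hj => hU _ ?_
  have := Finset.mem_range.1 hj
  exact not_dvd_three_mul (i := j + 1) (by omega) (by omega)

theorem val_termA_le (hM : 1 ≤ M) (hvq : v q = 1)
    (hU : ∀ i, ¬ 3 * M + 1 ∣ i → v (1 - q ^ i) = 1) {k : ℕ} (hk : k < 3 * M + 1) :
    v (termA q k) ≤ v (qShiftedFactorial q (q ^ 3) k) ^ 6 := by
  rw [termA, map_mul, map_mul, map_pow, map_div₀, map_pow, map_pow, hvq,
    val_qShiftedFactorial_cube_eq_one hU hk, one_pow, one_pow, mul_one, div_one]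
  exact mul_le_of_le_one_left' (val_qInteger_le_one hM hvq hU _)

theorem deformedTerm_congr (hr : r < 1) (hM : 1 ≤ M) (hvq : v q = 1)
    (hU : ∀ i, ¬ 3 * M + 1 ∣ i → v (1 - q ^ i) = 1) {lam : K} (hlam : v lam ≤ r ^ 5) {k : ℕ}
    (hk : k < 3 * M + 1) : ValCongr v (r ^ 5) (termA q k) (deformedTerm q lam k) := by
  have hr5 : r ^ 5 < 1 := pow_lt_one' hr (by norm_num)
  have hvp (i : ℕ) : v (q ^ i) = 1 := by rw [map_pow, hvq, one_pow]
  have h1 (i : ℕ) : v (1 - q ^ i) ≤ 1 := v.map_sub_le (by simp) (hvp i).le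
  have hz1 (j : ℕ) (hj : j ∈ Finset.range k) : v (1 - q ^ (3 * j + 3)) = 1 := by
    have := Finset.mem_range.1 hj
    exact hU _ (not_dvd_three_mul (i := j + 1) (by omega) (by omega))
  have hd (j : ℕ) (hj : j ∈ Finset.range k) :
      v ((1 - q ^ (3 * j + 3)) ^ 5 + lam * q ^ (3 * j + 3)) = 1 :=
    Valuation.map_eq_one_of_sub_lt (x := (1 - q ^ (3 * j + 3)) ^ 5)
      (by rw [map_pow, hz1 j hj, one_pow]) (by
        rw [add_sub_cancel_left, map_mul, hvp, mul_one]; exact hlam.trans_lt hr5)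
  have hqf := val_qShiftedFactorial_le_one hvq 1 k
  rw [pow_one] at hqf
  have hn : ValCongr v (r ^ 5) (∏ j ∈ Finset.range k, (1 - q ^ (3 * j + 1)) ^ 5)
      (∏ j ∈ Finset.range k, ((1 - q ^ (3 * j + 1)) ^ 5 - lam * (q ^ (3 * j + 1)) ^ 4)) := by
    refine ValCongr.prod (fun j _ => ?_) (fun j _ => ?_) fun j _ => ?_
    · rw [ValCongr, sub_sub_cancel, map_mul, map_pow, hvp, one_pow, mul_one]
      exact hlam
    · rw [map_pow]; exact pow_le_one' (h1 _) 5
    · refine v.map_sub_le (by rw [map_pow]; exact pow_le_one' (h1 _) 5) ?_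
      rw [map_mul, map_pow, hvp, one_pow, mul_one]
      exact hlam.trans hr5.le
  have hdc : ValCongr v (r ^ 5) (∏ j ∈ Finset.range k, (1 - q ^ (3 * j + 3)) ^ 5)
      (∏ j ∈ Finset.range k, ((1 - q ^ (3 * j + 3)) ^ 5 + lam * q ^ (3 * j + 3))) := by
    refine ValCongr.prod (fun j _ => ?_) (fun j _ => ?_) fun j hj => (hd j hj).le
    · rw [ValCongr, sub_add_cancel_left, Valuation.map_neg, map_mul, hvp, mul_one]
      exact hlam
    · rw [map_pow]; exact pow_le_one' (h1 _) 5
  have e : termA q k = qInteger q (6 * k + 1) *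
      ((qShiftedFactorial q (q ^ 3) k * ∏ j ∈ Finset.range k, (1 - q ^ (3 * j + 1)) ^ 5) /
        (qShiftedFactorial (q ^ 3) (q ^ 3) k * ∏ j ∈ Finset.range k, (1 - q ^ (3 * j + 3)) ^ 5)) *
      q ^ (3 * k) := by
    rw [termA, Finset.prod_pow, Finset.prod_pow, ← qShiftedFactorial_q_cube q 1,
      ← qShiftedFactorial_q_cube q 3, pow_one, ← pow_succ', ← pow_succ']
  have hvn : v (∏ j ∈ Finset.range k, (1 - q ^ (3 * j + 1)) ^ 5) ≤ 1 := by
    rw [map_prod]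
    exact Finset.prod_le_one' fun j _ => by rw [map_pow]; exact pow_le_one' (h1 _) 5
  have hq3 := val_qShiftedFactorial_cube_eq_one hU hk
  rw [e, deformedTerm, mul_comm, mul_comm _ (q ^ (3 * k))]
  refine ValCongr.mul_left (ValCongr.mul_left (ValCongr.div (hn.mul_left hqf) (hdc.mul_left hq3.le)
    ?_ ?_ ?_) (val_qInteger_le_one hM hvq hU _)) (hvp _).le
  · rw [map_mul]; exact mul_le_one' hqf hvn
  · rw [map_mul, hq3, one_mul, map_prod]
    exact Finset.prod_eq_one fun j hj => by rw [map_pow, hz1 j hj, one_pow]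
  · rw [map_mul, hq3, one_mul, map_prod]
    exact Finset.prod_eq_one hd

theorem double_sum_termA_congr (hM : 1 ≤ M) (hvq : v q = 1)
    (hU : ∀ i, ¬ 3 * M + 1 ∣ i → v (1 - q ^ i) = 1) (hn : v (1 - q ^ (3 * M + 1)) ≤ r) :
    ValCongr v (r ^ 6)
      (∑ p ∈ (Finset.range (3 * M + 1) ×ˢ Finset.range (3 * M + 1)).filter
        (fun p => p.1 + p.2 ≤ 3 * M + 1 - 1), termA q p.1 * termA q p.2)
      ((∑ k ∈ Finset.range (M + 1), termA q k) ^ 2) := by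
  have hqf (k : ℕ) : v (qShiftedFactorial q (q ^ 3) k) ≤ 1 := by
    simpa using val_qShiftedFactorial_le_one hvq 1 k
  have hle (k : ℕ) (hk : k < 3 * M + 1) : v (termA q k) ≤ 1 :=
    (val_termA_le hM hvq hU hk).trans (pow_le_one' (hqf k) 6)
  have hbig (k : ℕ) (hk : k < 3 * M + 1) (hk' : M < k) : v (termA q k) ≤ r ^ 6 := by
    refine (val_termA_le hM hvq hU hk).trans (pow_le_pow_left' ?_ 6)
    obtain ⟨l, rfl⟩ := Nat.exists_eq_add_of_lt hk'
    -- The factor of index `M` is 1 - q^(3M + 1).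
    rw [qShiftedFactorial, ← Finset.mul_prod_erase _ _ (Finset.mem_range.2 hk'), map_mul,
      ← pow_mul, ← pow_succ']
    refine (mul_le_of_le_one_right' ?_).trans hn
    rw [map_prod]
    exact Finset.prod_le_one' fun j _ => v.map_sub_le (by simp) (by
      rw [← pow_mul, ← pow_succ', map_pow, hvq, one_pow])
  -- Indices up to `M` have sum at most 2M ≤ n - 1, so the square lies in the triangle; a pair
  -- outside the square has an index above `M`.
  have hsub : Finset.range (M + 1) ×ˢ Finset.range (M + 1) ⊆
      (Finset.range (3 * M + 1) ×ˢ Finset.range (3 * M + 1)).filter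
        (fun p => p.1 + p.2 ≤ 3 * M + 1 - 1) := by
    intro p hp
    simp only [Finset.mem_product, Finset.mem_filter, Finset.mem_range] at hp ⊢
    omega
  rw [sq, Finset.sum_mul_sum, ← Finset.sum_product', ← Finset.sum_sdiff hsub, ValCongr,
    add_sub_cancel_right]
  refine v.map_sum_le fun p hp => ?_
  simp only [Finset.mem_sdiff, Finset.mem_product, Finset.mem_filter, Finset.mem_range] at hp
  rw [map_mul]
  by_cases h : M < p.1
  · exact (mul_le_of_le_one_right' (hle _ (by omega))).trans (hbig _ (by omega) h)
  · exact (mul_le_of_le_one_left' (hle _ (by omega))).trans (hbig _ (by omega) (by omega))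

theorem double_sum_congr_of_valuation (hr : r < 1) (hM : 1 ≤ M) (hvq : v q = 1)
    (hU : ∀ i, ¬ 3 * M + 1 ∣ i → v (1 - q ^ i) = 1) (hn : v (1 - q ^ (3 * M + 1)) ≤ r)
    (hq : ∀ j, 1 ≤ j → q ^ j ≠ 1) :
    ValCongr v (r ^ 6)
      (∑ p ∈ (Finset.range (3 * M + 1) ×ˢ Finset.range (3 * M + 1)).filter
        (fun p => p.1 + p.2 ≤ 3 * M + 1 - 1), termA q p.1 * termA q p.2)
      (qInteger q (3 * M + 1) ^ 2 *
        (qShiftedFactorial (q ^ 2) (q ^ 3) M ^ 6 / qShiftedFactorial (q ^ 3) (q ^ 3) M ^ 6) *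
        (1 + 2 * qInteger q (3 * M + 1) ^ 2 * (2 - q ^ (3 * M + 1)) *
          ∑ r ∈ Finset.Icc 1 M, (q ^ (3 * r - 1) / qInteger q (3 * r - 1) ^ 2 -
              q ^ (3 * r) / qInteger q (3 * r) ^ 2))) := by
  have hr' := hr.le
  have hq0 := ne_zero_of_val_eq_one hvq
  have hqn : q ^ (3 * M + 1) ≠ 0 := pow_ne_zero _ hq0
  obtain ⟨y, hy⟩ : ∃ y, y * q ^ (3 * M + 1) = 1 := ⟨_, inv_mul_cancel₀ hqn⟩
  have hvy : v y = 1 := by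
    have := congrArg v hy
    rwa [map_mul, map_pow, hvq, one_pow, mul_one, map_one] at this
  have hy0 := ne_zero_of_val_eq_one hvy
  have hqy : q ^ (3 * M + 1) = 1 / y := by field_simp; linear_combination hy
  have hε : v (y - 1) ≤ r := by
    rw [show y - 1 = y * (1 - q ^ (3 * M + 1)) by rw [hqy]; field_simp, map_mul, hvy, one_mul]
    exact hn
  have hlam : v ((y - 1) ^ 5 / y) ≤ r ^ 5 := by
    rw [map_div₀, map_pow, hvy, div_one]; exact pow_le_pow_left' hε 5
  have h1 : v (1 - q) = 1 := by
    simpa using hU 1 (Nat.not_dvd_of_pos_of_lt one_pos (by omega))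
  have hq1 := ne_zero_of_val_eq_one h1
  have hF : ∀ r, 1 ≤ r → r ≤ M + 1 →
      (1 - q ^ (3 * r)) ^ 5 + (y - 1) ^ 5 / y * q ^ (3 * r) ≠ 0 := by
    intro j hj hj'
    refine ne_zero_of_val_eq_one (v := v) (Valuation.map_eq_one_of_sub_lt
      (x := (1 - q ^ (3 * j)) ^ 5) ?_ ?_)
    · rw [map_pow, hU _ (not_dvd_three_mul hj (by omega)), one_pow]
    · rw [add_sub_cancel_left, map_mul, map_pow v q, hvq, one_pow, mul_one]
      exact hlam.trans_lt (pow_lt_one' hr (by norm_num))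
  have hsq := sq_sum_deformedTerm M hq0 hq hy hF
  have hprod := prod_factor_congr hr hvq hU hy hε
  have hint : v (qInteger q (3 * M + 1)) ≤ r := by
    rw [qInteger, map_div₀, h1, div_one]; exact hn
  have hc : ∏ j ∈ Finset.range M, (1 - q ^ (3 * j + 2)) ^ 6 / (1 - q ^ (3 * j + 3)) ^ 6 =
      qShiftedFactorial (q ^ 2) (q ^ 3) M ^ 6 / qShiftedFactorial (q ^ 3) (q ^ 3) M ^ 6 := by
    rw [Finset.prod_div_distrib, Finset.prod_pow, Finset.prod_pow, qShiftedFactorial_q_cube,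
      qShiftedFactorial_q_cube]
  have hb : 2 * ((1 - 1 / y) ^ 2 * (2 - 1 / y)) * ∑ j ∈ Finset.range M,
      (q ^ (3 * j + 2) / (1 - q ^ (3 * j + 2)) ^ 2 -
        q ^ (3 * j + 3) / (1 - q ^ (3 * j + 3)) ^ 2) =
      2 * qInteger q (3 * M + 1) ^ 2 * (2 - q ^ (3 * M + 1)) *
        ∑ r ∈ Finset.Icc 1 M, (q ^ (3 * r - 1) / qInteger q (3 * r - 1) ^ 2 -
          q ^ (3 * r) / qInteger q (3 * r) ^ 2) := by
    have e (w : K) : w / ((1 - w) / (1 - q)) ^ 2 = (1 - q) ^ 2 * (w / (1 - w) ^ 2) := by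
      rw [div_pow, div_div_eq_mul_div]; ring
    rw [← Finset.Ico_add_one_right_eq_Icc, Finset.sum_Ico_eq_sum_range, add_tsub_cancel_right]
    have hs : ∀ j ∈ Finset.range M, q ^ (3 * (1 + j) - 1) / qInteger q (3 * (1 + j) - 1) ^ 2 -
        q ^ (3 * (1 + j)) / qInteger q (3 * (1 + j)) ^ 2 = (1 - q) ^ 2 *
        (q ^ (3 * j + 2) / (1 - q ^ (3 * j + 2)) ^ 2 -
          q ^ (3 * j + 3) / (1 - q ^ (3 * j + 3)) ^ 2) := by
      intro j _
      rw [show 3 * (1 + j) - 1 = 3 * j + 2 by omega, show 3 * (1 + j) = 3 * j + 3 by ring,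
        qInteger, qInteger, e, e, mul_sub]
    rw [Finset.sum_congr rfl hs, ← Finset.mul_sum, qInteger, hqy]
    field_simp
  rw [hc, hb] at hprod
  have hdef : ValCongr v (r ^ 5) (∑ k ∈ Finset.range (M + 1), termA q k)
      (∑ k ∈ Finset.range (M + 1), deformedTerm q ((y - 1) ^ 5 / y) k) :=
    ValCongr.sum fun k hk => deformedTerm_congr hr hM hvq hU hlam (by
      have := Finset.mem_range.1 hk; omega)
  have hcv : v (qShiftedFactorial (q ^ 2) (q ^ 3) M ^ 6 /
      qShiftedFactorial (q ^ 3) (q ^ 3) M ^ 6) ≤ 1 := by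
    rw [map_div₀, map_pow v (qShiftedFactorial (q ^ 3) _ _),
      val_qShiftedFactorial_cube_eq_one hU (by omega), one_pow, div_one, map_pow]
    exact pow_le_one' (val_qShiftedFactorial_le_one hvq 2 M) 6
  have hsv : v (∑ j ∈ Finset.range M, (q ^ (3 * j + 2) / (1 - q ^ (3 * j + 2)) ^ 2 -
      q ^ (3 * j + 3) / (1 - q ^ (3 * j + 3)) ^ 2)) ≤ 1 := by
    refine v.map_sum_le fun j hj => ?_
    have hj := Finset.mem_range.1 hj
    have h2 (i : ℕ) (hi : ¬ 3 * M + 1 ∣ i) : v (q ^ i / (1 - q ^ i) ^ 2) ≤ 1 := by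
      rw [map_div₀, map_pow, map_pow, hvq, hU i hi]; simp
    exact v.map_sub_le (h2 _ (Nat.not_dvd_of_pos_of_lt (by omega) (by omega)))
      (h2 _ (Nat.not_dvd_of_pos_of_lt (by omega) (by omega)))
  have hyv : v (1 / y) = 1 := by rw [map_div₀, map_one, hvy, div_one]
  have hright : v (qShiftedFactorial (q ^ 2) (q ^ 3) M ^ 6 /
      qShiftedFactorial (q ^ 3) (q ^ 3) M ^ 6 *
      (1 + 2 * qInteger q (3 * M + 1) ^ 2 * (2 - q ^ (3 * M + 1)) *
        ∑ r ∈ Finset.Icc 1 M, (q ^ (3 * r - 1) / qInteger q (3 * r - 1) ^ 2 -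
          q ^ (3 * r) / qInteger q (3 * r) ^ 2))) ≤ 1 := by
    rw [← hb, map_mul]
    refine mul_le_one' hcv (v.map_add_le (by simp) ?_)
    rw [map_mul, map_mul, map_mul, map_pow]
    refine mul_le_one' (mul_le_one' (v.map_ofNat_le_one 2) (mul_le_one' (pow_le_one' ?_ 2) ?_)) hsv
    · exact v.map_sub_le (by simp) hyv.le
    · exact v.map_sub_le (v.map_ofNat_le_one 2) hyv.le
  -- The bound for the sum is read off from its square, where [n]^2 is explicit.
  have hdv : v (∑ k ∈ Finset.range (M + 1), deformedTerm q ((y - 1) ^ 5 / y) k) ≤ r := by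
    have hp := hprod.symm.le_one (pow_le_one' hr' 4) hright
    rw [← pow_le_pow_iff_left₀ zero_le zero_le two_ne_zero, ← map_pow, hsq, map_mul, map_pow]
    exact (mul_le_of_le_one_right' hp).trans (pow_le_pow_left' hint 2)
  have hsv : v (∑ k ∈ Finset.range (M + 1), termA q k) ≤ r := by
    rw [← sub_add_cancel (∑ k ∈ Finset.range (M + 1), termA q k)
      (∑ k ∈ Finset.range (M + 1), deformedTerm q ((y - 1) ^ 5 / y) k)]
    exact v.map_add_le (hdef.mono
      ((pow_le_pow_right_of_le_one' hr' (by norm_num : 1 ≤ 5)).trans_eq (pow_one r))) hdv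
  refine (double_sum_termA_congr hM hvq hU hn).trans (ValCongr.trans
    (y := (∑ k ∈ Finset.range (M + 1), deformedTerm q ((y - 1) ^ 5 / y) k) ^ 2) ?_ ?_)
  -- In (S - S')(S + S') the first factor has valuation at most `r ^ 5` and the second at most `r`.
  · rw [ValCongr, sq_sub_sq, map_mul, mul_comm, pow_succ r 5]
    exact mul_le_mul' hdef (v.map_add_le hsv hdv)
  -- The factor [n]^2 contributes `r ^ 2`, so precision `r ^ 4` suffices for the product.
  · rw [hsq, mul_assoc, ValCongr, ← mul_sub, map_mul, map_pow, show r ^ 6 = r ^ 2 * r ^ 4 by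
      rw [← pow_add]]
    exact mul_le_mul' (pow_le_pow_left' hint 2) hprod

end Supercongruence

/-! ### The cyclotomic place of ℚ(q) and the conclusion. -/

section Cyclotomic

theorem dvd_of_cyclotomic_dvd_X_pow_sub_one {n i : ℕ} (hn : 0 < n)
    (h : cyclotomic n ℚ ∣ X ^ i - 1) : n ∣ i := by
  have hζ := Complex.isPrimitiveRoot_exp n hn.ne'
  have h0 : aeval (Complex.exp (2 * Real.pi * Complex.I / n)) (cyclotomic n ℚ) = 0 := by
    rw [aeval_def, eval₂_eq_eval_map, map_cyclotomic]
    exact hζ.isRoot_cyclotomic hn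
  obtain ⟨p, hp⟩ := h
  have := congrArg (aeval (Complex.exp (2 * Real.pi * Complex.I / n))) hp
  rw [map_mul, h0, zero_mul] at this
  simp only [map_sub, map_pow, aeval_X, map_one, sub_eq_zero] at this
  exact hζ.dvd_of_pow_eq_one i this

/-- The place of `ℚ[X]` given by the `n`-th cyclotomic polynomial. -/
noncomputable def cyclotomicPlace (n : ℕ) (hn : 0 < n) : IsDedekindDomain.HeightOneSpectrum ℚ[X] where
  asIdeal := Ideal.span {cyclotomic n ℚ}
  isPrime := (Ideal.span_singleton_prime (cyclotomic_ne_zero n ℚ)).2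
    (cyclotomic.irreducible_rat hn).prime
  ne_bot := by
    rw [Ne, Ideal.span_singleton_eq_bot]
    exact cyclotomic_ne_zero n ℚ

-- The numerator is f - g times its denominator, a polynomial of valuation at most 1, so it inherits
-- the bound, which for a polynomial means membership in the `m`-th power of the ideal.
open WithZero in
theorem ratFuncCongr_of_valCongr {n : ℕ} (hn : 0 < n) (m : ℕ) {f g : RatFunc ℚ}
    (h : ValCongr ((cyclotomicPlace n hn).valuation (RatFunc ℚ)) (exp (-1) ^ m) f g) :
    RatFuncCongr (cyclotomic n ℚ ^ m) f g := by
  rw [RatFuncCongr, ← Ideal.mem_span_singleton, ← Ideal.span_singleton_pow]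
  change _ ∈ (cyclotomicPlace n hn).asIdeal ^ m
  rw [← (cyclotomicPlace n hn).intValuation_le_pow_iff_mem,
    ← (cyclotomicPlace n hn).valuation_of_algebraMap (K := RatFunc ℚ)]
  have hd : algebraMap ℚ[X] (RatFunc ℚ) (f - g).denom ≠ 0 :=
    RatFunc.algebraMap_ne_zero (RatFunc.denom_ne_zero _)
  refine (congrArg _ ((div_eq_iff hd).1 (RatFunc.num_div_denom (f - g)))).trans_le ?_
  rw [map_mul]
  refine (mul_le_of_le_one_right' ((cyclotomicPlace n hn).valuation_le_one _)).trans ?_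
  rw [ValCongr, ← exp_nsmul] at h
  simpa using h

end Cyclotomic

open WithZero in
theorem theorem1p1 (n : ℕ) (hn : n ≡ 1 [MOD 3]) (q : RatFunc ℚ) (hq : q = RatFunc.X) :
    RatFuncCongr (cyclotomic n ℚ ^ 6)
      (∑ p ∈ (Finset.range n ×ˢ Finset.range n).filter (fun p => p.1 + p.2 ≤ n - 1),
        termA q p.1 * termA q p.2)
      (qInteger q n ^ 2 *
        (qShiftedFactorial (q ^ 2) (q ^ 3) ((n - 1) / 3) ^ 6 /
          qShiftedFactorial (q ^ 3) (q ^ 3) ((n - 1) / 3) ^ 6) *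
        (1 + 2 * qInteger q n ^ 2 * (2 - q ^ n) *
          ∑ r ∈ Finset.Icc 1 ((n - 1) / 3),
            (q ^ (3 * r - 1) / qInteger q (3 * r - 1) ^ 2 -
              q ^ (3 * r) / qInteger q (3 * r) ^ 2))) := by
  obtain ⟨M, rfl⟩ : ∃ M, n = 3 * M + 1 := ⟨n / 3, by rw [Nat.ModEq] at hn; omega⟩
  have hpos : 0 < 3 * M + 1 := by omega
  have hX (i : ℕ) : 1 - q ^ i = algebraMap ℚ[X] (RatFunc ℚ) (1 - X ^ i) := by
    rw [hq]; simp
  have hqj : ∀ j, 1 ≤ j → q ^ j ≠ 1 := by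
    intro j hj h
    have h0 := hX j
    rw [h, sub_self] at h0
    have h1 := (map_eq_zero_iff _ (RatFunc.algebraMap_injective ℚ)).1 h0.symm
    exact X_pow_sub_C_ne_zero (R := ℚ) (by omega : 0 < j) 1 (by
      rw [map_one]; linear_combination -h1)
  rw [show (3 * M + 1 - 1) / 3 = M by omega]
  -- For n = 1 the element 1 - q is not a unit at Φ_1, so the general argument does not apply; here
  -- both sides are 1.
  rcases Nat.eq_zero_or_pos M with rfl | hM
  · have h1 : qInteger q 1 = 1 := by
      rw [qInteger, pow_one]
      exact div_self (sub_ne_zero.2 (by simpa using (hqj 1 le_rfl).symm))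
    simp [RatFuncCongr, termA, qShiftedFactorial, h1, Finset.sum_filter]
  let P := cyclotomicPlace (3 * M + 1) hpos
  have hU (i : ℕ) (hi : ¬ 3 * M + 1 ∣ i) : P.valuation (RatFunc ℚ) (1 - q ^ i) = 1 := by
    rw [hX, P.valuation_of_algebraMap, IsDedekindDomain.HeightOneSpectrum.intValuation_eq_one_iff]
    intro h
    have h := Ideal.mem_span_singleton.1 h
    rw [← dvd_neg, neg_sub] at h
    exact hi (dvd_of_cyclotomic_dvd_X_pow_sub_one hpos h)
  have hn : P.valuation (RatFunc ℚ) (1 - q ^ (3 * M + 1)) ≤ exp (-1) := by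
    rw [hX, P.valuation_of_algebraMap]
    have := (P.intValuation_le_pow_iff_mem (1 - X ^ (3 * M + 1)) 1).2
    refine this ?_
    rw [pow_one]
    refine Ideal.mem_span_singleton.2 ?_
    rw [← dvd_neg, neg_sub]
    exact cyclotomic.dvd_X_pow_sub_one _ _
  have hlt : exp (-1 : ℤ) < 1 := by rw [← exp_zero, exp_lt_exp]; norm_num
  have hvq : P.valuation (RatFunc ℚ) q = 1 := by
    have h1 : P.valuation (RatFunc ℚ) (q ^ (3 * M + 1)) = 1 :=
      Valuation.map_eq_one_of_sub_lt (map_one _) (by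
        rw [Valuation.map_sub_swap]; exact hn.trans_lt hlt)
    rw [map_pow] at h1
    -- The power q^n is congruent to 1, hence a unit, and so is q.
    exact (pow_eq_one_iff_of_nonneg zero_le (by omega)).1 h1
  exact ratFuncCongr_of_valCongr hpos 6 (double_sum_congr_of_valuation hlt hM hvq hU hn hqj)
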